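/- All rings are associative and unital, and ring homomorphisms preserve units. For parallel ring homomorphisms $\alpha,\beta:A\to B$ let $\mathrm{Hom}(\alpha,\beta)=\{t\in B: t\alpha(a)=\beta(a)t\ \forall a\in A\}$ and $\mathrm{End}\,\alpha=\mathrm{Hom}(\alpha,\alpha)$, a subring of $B$. Write $\alpha\le\beta$ if there are finitely many $b_i\in\mathrm{Hom}(\alpha,\beta)$, $a_i\in\mathrm{Hom}(\beta,\alpha)$ with $\sum_i a_ib_i=1_B$. A homomorphism $\lambda:A\to B$ is left adjoint to $\rho:B\to A$ (in the 2-category $\mathsf{Ring}$) if there are $e\in\mathrm{Hom}(\lambda\rho,\mathrm{id}_B)$ and $m\in\mathrm{Hom}(\mathrm{id}_A,\rho\lambda)$ with $\rho(e)m=1_A$ and $e\lambda(m)=1_B$; then $\rho$ is called right adjoint. A right bialgebroid over a ring $R$ is a ring $H$ with ring homomorphisms $s:R\to H$, $t:R^{op}\to H$ with commuting images and, for the bimodule structure $r\cdot h\cdot r'=h\,s(r')t(r)$, an $R$-coring structure given by $R$-$R$-bimodule maps $\Delta:H\to H\otimes_RH$, $h\mapsto h_{(1)}\otimes h_{(2)}$,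 and $\varepsilon:H\to R$ (coassociative and counital) such that $s(r)h_{(1)}\otimes h_{(2)}=h_{(1)}\otimes t(r)h_{(2)}$, $\Delta(1)=1\otimes 1$, $\Delta(gh)=\Delta(g)\Delta(h)$, $\varepsilon(1)=1$ and $\varepsilon(gh)=\varepsilon(s(\varepsilon(g))h)=\varepsilon(t(\varepsilon(g))h)$ for all $g,h\in H$, $r\in R$. It is left finite projective if $_RH$ is finitely generated projective. A right $H$-comodule algebra is a ring $A$ with a ring homomorphism $\pi:R\to A$ and a coassociative, counital, right $R$-linear map $\delta:A\to A\otimes_RH$, $a\mapsto a_{(0)}\otimes a_{(1)}$ (where $a\cdot r=a\pi(r)$), such that $\pi(r)a_{(0)}\otimes a_{(1)}=a_{(0)}\otimes t(r)a_{(1)}$, $\delta(1)=1\otimes1$ and $\delta(aa')=\delta(a)\delta(a')$. A ring homomorphism $\rho:B\to A$ is right $H$-Galois, with respect to such a structure on $A$, if $\{a\in A:\delta(a)=a\otimes1\}=\rho(B)$ and the map $A\otimes_BA\to A\otimes_RH$, $a\otimes a'\mapsto aa'_{(0)}\otimes a'_{(1)}$, is bijective. **Corollary.** For a ring homomorphism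 $\rho:B\to A$ the following conditions are equivalent: 1. There are a left finite projective right bialgebroid $H$ over $R=\mathrm{End}\,\rho$ and a right $H$-comodule algebra structure on $A$ with respect to which $\rho$ is right $H$-Galois, and ${}_BA\cong{}_BB$ as left $B$-modules, where $B$ acts on $A$ through $\rho$. 2. Condition 1 holds with a comodule algebra structure for which $\pi:R\to A$ is the inclusion $\mathrm{End}\,\rho\subseteq A$. 3. $\rho$ has a left adjoint $\lambda$ with $\rho\lambda\rho\le\rho$. 4. $\rho$ has a left adjoint, and $\rho\lambda\rho\le\rho$ for every left adjoint $\lambda$ of $\rho$. -/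

import Mathlib

open scoped TensorProduct

universe u v w

/-! ### The 2-category of rings -/

section TwoCategory

variable {A : Type u} {B : Type v} [Ring A] [Ring B]

/-- `t ∈ B` is a 2-cell `α ⟶ β`, i.e. `t α(a) = β(a) t` for all `a`. Vertical composition of 2-cells is
multiplication in `B`. -/
def IsIntertwiner (α β : A →+* B) (t : B) : Prop :=
  ∀ a : A, t * α a = β a * t

/-- The ring `End ρ` of 2-cells `ρ ⟶ ρ`, a subring of the target of `ρ`. -/
def endRing (ρ : A →+* B) : Subring B where
  carrier := {t | IsIntertwiner ρ ρ t}
  mul_mem' := by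
    intro x y hx hy a
    rw [mul_assoc, hy a, ← mul_assoc, hx a, mul_assoc]
  one_mem' := fun a => by rw [one_mul, mul_one]
  add_mem' := by
    intro x y hx hy a
    rw [add_mul, mul_add, hx a, hy a]
  zero_mem' := fun a => by rw [zero_mul, mul_zero]
  neg_mem' := by
    intro x hx a
    rw [neg_mul, mul_neg, hx a]

/-- `λ ⊣ ρ` in the 2-category of rings: there are 2-cells `e : λρ ⟶ id_B` and `m : id_A ⟶ ρλ` satisfying
the triangle identities. -/
def IsLeftAdjoint (lam : A →+* B) (ρ : B →+* A) : Prop :=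
  ∃ (e : B) (m : A),
    IsIntertwiner (lam.comp ρ) (RingHom.id B) e ∧
    IsIntertwiner (RingHom.id A) (ρ.comp lam) m ∧
    ρ e * m = 1 ∧ e * lam m = 1

/-- The preorder `ρ ≤ σ` on parallel ring homomorphisms: there is a direct summand diagram
`ρ --bᵢ--> σ --aᵢ--> ρ` with `∑ aᵢ bᵢ = 1`. -/
def IsSummandOf (ρ σ : A →+* B) : Prop :=
  ∃ (n : ℕ) (a b : Fin n → B),
    (∀ i, IsIntertwiner ρ σ (b i)) ∧ (∀ i, IsIntertwiner σ ρ (a i)) ∧ ∑ i, a i * b i = 1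

/-- `ρ : A → B` is left regular: `B` with the left `A`-action `a · b = ρ(a) b` is isomorphic to the
left regular `A`-module. -/
def IsLeftRegularHom (ρ : A →+* B) : Prop :=
  ∃ f : A ≃+ B, ∀ a x : A, f (a * x) = ρ a * f x

end TwoCategory

/-! ### Tensor products over a noncommutative ring -/

section BalTensor

/-- The subgroup of `M ⊗ N` generated by all `m·r ⊗ n - m ⊗ r·n`. -/
def balancedRel {R M N : Type*} [AddCommGroup M] [AddCommGroup N]
    (f : R → M →+ M) (g : R → N →+ N) : AddSubgroup (M ⊗[ℤ] N) :=
  AddSubgroup.closure {z | ∃ (r : R) (m : M) (n : N), z = f r m ⊗ₜ[ℤ] n - m ⊗ₜ[ℤ] g r n}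

/-- The tensor product `M ⊗_R N` of a right `R`-module `M` and a left `R`-module `N`, where
`m · r = f r m` and `r · n = g r n`. -/
def BalTensor {R M N : Type*} [AddCommGroup M] [AddCommGroup N]
    (f : R → M →+ M) (g : R → N →+ N) : Type _ :=
  (M ⊗[ℤ] N) ⧸ balancedRel f g

namespace BalTensor

variable {R M N M' N' P S : Type*} [AddCommGroup M] [AddCommGroup N] [AddCommGroup M']
  [AddCommGroup N'] [AddCommGroup P] [AddCommGroup S]

instance instAddCommGroup (f : R → M →+ M) (g : R → N →+ N) : AddCommGroup (BalTensor f g) :=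
  inferInstanceAs (AddCommGroup ((M ⊗[ℤ] N) ⧸ balancedRel f g))

/-- The quotient map `M ⊗ N → M ⊗_R N`. -/
def proj (f : R → M →+ M) (g : R → N →+ N) : M ⊗[ℤ] N →+ BalTensor f g :=
  QuotientAddGroup.mk' (balancedRel f g)

/-- The balanced biadditive map `(m, n) ↦ m ⊗ n`. -/
def mk (f : R → M →+ M) (g : R → N →+ N) : M →+ N →+ BalTensor f g :=
  AddMonoidHom.mk' (fun m =>
    AddMonoidHom.mk' (fun n => proj f g (m ⊗ₜ[ℤ] n))
      (fun n n' => by rw [TensorProduct.tmul_add, map_add]))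
    (fun m m' => by
      ext n
      simp [TensorProduct.add_tmul])

theorem mk_balanced (f : R → M →+ M) (g : R → N →+ N) (r : R) (m : M) (n : N) :
    mk f g (f r m) n = mk f g m (g r n) := by
  refine (QuotientAddGroup.eq_iff_sub_mem).2 ?_
  exact AddSubgroup.subset_closure ⟨r, m, n, rfl⟩

variable {f : R → M →+ M} {g : R → N →+ N} {f' : R → M' →+ M'} {g' : R → N' →+ N'}

/-- The universal property of `M ⊗_R N`. -/
def lift (φ : M →+ N →+ P) (h : ∀ r m n, φ (f r m) n = φ m (g r n)) : BalTensor f g →+ P :=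
  QuotientAddGroup.lift (balancedRel f g)
    (TensorProduct.liftAddHom φ (fun k m n => by
      rw [map_zsmul, map_zsmul, AddMonoidHom.coe_smul, Pi.smul_apply]))
    (by
      refine (AddSubgroup.closure_le _).2 ?_
      rintro _ ⟨r, m, n, rfl⟩
      simp [h r m n])

@[simp]
theorem lift_mk (φ : M →+ N →+ P) (h : ∀ r m n, φ (f r m) n = φ m (g r n)) (m : M) (n : N) :
    lift (f := f) (g := g) φ h (mk f g m n) = φ m n := rfl

theorem hom_ext {φ ψ : BalTensor f g →+ P} (h : ∀ m n, φ (mk f g m n) = ψ (mk f g m n)) :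
    φ = ψ := by
  refine QuotientAddGroup.addMonoidHom_ext _ ?_
  ext z
  induction z using TensorProduct.induction_on with
  | zero => rw [map_zero, map_zero]
  | tmul m n => exact h m n
  | add x y hx hy => rw [map_add, map_add, hx, hy]

/-- `φ ⊗ ψ` for a right `R`-linear `φ` and a left `R`-linear `ψ`. -/
def map (φ : M →+ M') (ψ : N →+ N') (hφ : ∀ r m, φ (f r m) = f' r (φ m))
    (hψ : ∀ r n, ψ (g r n) = g' r (ψ n)) : BalTensor f g →+ BalTensor f' g' :=
  lift (((mk f' g').compl₂ ψ).comp φ)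
    (fun r m n => by
      change mk f' g' (φ (f r m)) (ψ n) = mk f' g' (φ m) (ψ (g r n))
      rw [hφ, hψ, mk_balanced])

@[simp]
theorem map_mk (φ : M →+ M') (ψ : N →+ N') (hφ : ∀ r m, φ (f r m) = f' r (φ m))
    (hψ : ∀ r n, ψ (g r n) = g' r (ψ n)) (m : M) (n : N) :
    map (f := f) (g := g) (f' := f') (g' := g') φ ψ hφ hψ (mk f g m n) = mk f' g' (φ m) (ψ n) := rfl

/-- The right `R`-action on `M ⊗_R N` induced by a right `R`-action `k` on the bimodule `N`. -/
def rightAct (f : R → M →+ M) (g k : R → N →+ N) (hgk : ∀ r r' n, k r' (g r n) = g r (k r' n)) :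
    R → BalTensor f g →+ BalTensor f g :=
  fun r' => map (AddMonoidHom.id M) (k r') (fun _ _ => rfl) (fun r n => hgk r r' n)

/-- The left `R`-action on `N ⊗_R S` induced by a left `R`-action `g` on the bimodule `N`. -/
def leftAct (g k : R → N →+ N) (l : R → S →+ S) (hgk : ∀ r r' n, k r' (g r n) = g r (k r' n)) :
    R → BalTensor k l →+ BalTensor k l :=
  fun r => map (g r) (AddMonoidHom.id S) (fun r' n => (hgk r r' n).symm) (fun _ _ => rfl)

/-- The map `(m ⊗ n) ↦ (z ↦ m ⊗ (n ⊗ z))`. -/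
def assocAux (f : R → M →+ M) (g k : R → N →+ N) (l : R → S →+ S)
    (hgk : ∀ r r' n, k r' (g r n) = g r (k r' n)) :
    BalTensor f g →+ S →+ BalTensor f (leftAct g k l hgk) :=
  lift
    (AddMonoidHom.mk' (fun m =>
        AddMonoidHom.mk' (fun n => (mk f (leftAct g k l hgk) m).comp (mk k l n))
          (fun n n' => by ext z; simp))
      (fun m m' => by ext n z; simp))
    (fun r m n => by
      ext z
      exact mk_balanced f (leftAct g k l hgk) r m (mk k l n z))

/-- The associativity map `(M ⊗_R N) ⊗_R S → M ⊗_R (N ⊗_R S)`, `(m ⊗ n) ⊗ z ↦ m ⊗ (n ⊗ z)`. -/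
def assoc (f : R → M →+ M) (g k : R → N →+ N) (l : R → S →+ S)
    (hgk : ∀ r r' n, k r' (g r n) = g r (k r' n)) :
    BalTensor (rightAct f g k hgk) l →+ BalTensor f (leftAct g k l hgk) :=
  lift (assocAux f g k l hgk)
    (fun r x z => by
      have key : ((assocAux f g k l hgk).flip z).comp (rightAct f g k hgk r) =
          (assocAux f g k l hgk).flip (l r z) :=
        hom_ext fun m n => congrArg (mk f (leftAct g k l hgk) m) (mk_balanced k l r n z)
      exact DFunLike.congr_fun key x)

end BalTensor

end BalTensor

/-! ### The Takeuchi product -/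

section Takeuchi

variable {R P Q : Type*} [Ring P] [Ring Q]

/-- `P ⊗_R Q` for rings `P`, `Q` with right `R`-action `x · r = x p(r)` on `P` and left `R`-action
`r · y = y q(r)` on `Q`. -/
abbrev RingTensor (p : R → P) (q : R → Q) : Type _ :=
  BalTensor (fun r => AddMonoidHom.mulRight (p r)) (fun r => AddMonoidHom.mulRight (q r))

namespace RingTensor

/-- The element `x ⊗ y` of `P ⊗_R Q`. -/
abbrev tmul (p : R → P) (q : R → Q) (x : P) (y : Q) : RingTensor p q :=
  BalTensor.mk (fun r => AddMonoidHom.mulRight (p r)) (fun r => AddMonoidHom.mulRight (q r)) x y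

/-- Factorwise left multiplication `x' ⊗ y' ↦ x x' ⊗ y y'`, biadditive in `(x, y)`. -/
def lmul (p : R → P) (q : R → Q) : P →+ Q →+ (RingTensor p q →+ RingTensor p q) :=
  AddMonoidHom.mk' (fun x =>
    AddMonoidHom.mk' (fun y =>
        BalTensor.map (AddMonoidHom.mulLeft x) (AddMonoidHom.mulLeft y)
          (fun r x' => (mul_assoc x x' (p r)).symm) (fun r y' => (mul_assoc y y' (q r)).symm))
      (fun y y' => BalTensor.hom_ext fun a b => by
        change tmul p q (x * a) ((y + y') * b) = tmul p q (x * a) (y * b) + tmul p q (x * a) (y' * b)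
        simp only [tmul, add_mul, map_add]))
    (fun x x' => by
      ext1 y
      exact BalTensor.hom_ext fun a b => by
        change tmul p q ((x + x') * a) (y * b) = tmul p q (x * a) (y * b) + tmul p q (x' * a) (y * b)
        simp only [tmul, add_mul, map_add, AddMonoidHom.add_apply])

theorem lmul_tmul (p : R → P) (q : R → Q) (x x' : P) (y y' : Q) :
    lmul p q x y (tmul p q x' y') = tmul p q (x * x') (y * y') := rfl

theorem lmul_mul (p : R → P) (q : R → Q) (x x' : P) (y y' : Q) (z : RingTensor p q) :
    lmul p q (x * x') (y * y') z = lmul p q x y (lmul p q x' y' z) := by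
  have h : lmul p q (x * x') (y * y') = (lmul p q x y).comp (lmul p q x' y') :=
    BalTensor.hom_ext fun a b => by
      change tmul p q (x * x' * a) (y * y' * b) = tmul p q (x * (x' * a)) (y * (y' * b))
      rw [mul_assoc, mul_assoc]
  rw [h, AddMonoidHom.comp_apply]

/-- The Takeuchi product `P ×_R Q`: all `∑ xᵢ ⊗ yᵢ` with `∑ p(r) xᵢ ⊗ yᵢ = ∑ xᵢ ⊗ q(r) yᵢ`
for every `r`. -/
def takeuchi (p : R → P) (q : R → Q) : AddSubgroup (RingTensor p q) where
  carrier := {z | ∀ r : R, lmul p q (p r) 1 z = lmul p q 1 (q r) z}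
  add_mem' := by
    intro z z' hz hz' r
    rw [map_add, map_add, hz r, hz' r]
  zero_mem' := fun r => by rw [map_zero, map_zero]
  neg_mem' := by
    intro z hz r
    rw [map_neg, map_neg, hz r]

/-- The factorwise product `(∑ xᵢ ⊗ yᵢ) (∑ xⱼ' ⊗ yⱼ') = ∑ xᵢ xⱼ' ⊗ yᵢ yⱼ'`, which is well defined as
soon as the second factor lies in the Takeuchi product. -/
def takeuchiMul (p : R → P) (q : R → Q) :
    RingTensor p q →+ takeuchi p q →+ RingTensor p q :=
  BalTensor.lift
    (AddMonoidHom.mk' (fun x =>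
        AddMonoidHom.mk' (fun y => (lmul p q x y).comp (takeuchi p q).subtype)
          (fun y y' => by ext z; simp))
      (fun x x' => by ext y z; simp))
    (fun r x y => by
      ext ⟨z, hz⟩
      change lmul p q (x * p r) y z = lmul p q x (y * q r) z
      have h1 := lmul_mul p q x (p r) y 1 z
      have h2 := lmul_mul p q x 1 y (q r) z
      rw [mul_one] at h1 h2
      rw [h1, h2, hz r])

end RingTensor

end Takeuchi

/-! ### Right bialgebroids -/

/-- A ring `H` with a source map `s : R → H` and a target map `t : Rᵒᵖ → H` whose images commute.
It is an `R`-`R`-bimodule by `r · h · r' = h s(r') t(r)`. -/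
structure SourceTarget (R : Type u) [Ring R] (H : Type v) [Ring H] where
  s : R →+* H
  t : Rᵐᵒᵖ →+* H
  comm : ∀ (r : R) (r' : Rᵐᵒᵖ), s r * t r' = t r' * s r

namespace SourceTarget

variable {R : Type u} [Ring R] {H : Type v} [Ring H] (E : SourceTarget R H)
  {P : Type w} [Ring P] (p : R →+* P)

/-- The target map as a function on `R`. -/
def tgt (r : R) : H := E.t (MulOpposite.op r)

/-- `P ⊗_R H` for an `R`-ring `p : R → P`, with respect to `x · r = x p(r)` and `r · h = h t(r)`.
For `p = s` this is `H ⊗_R H`. -/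
abbrev Tensor : Type _ := RingTensor p E.tgt

/-- The element `x ⊗ h` of `P ⊗_R H`. -/
abbrev tmul (x : P) (h : H) : E.Tensor p := RingTensor.tmul p E.tgt x h

theorem act_comm (r r' : R) (h : H) :
    AddMonoidHom.mulRight (E.s r') (AddMonoidHom.mulRight (E.tgt r) h) =
      AddMonoidHom.mulRight (E.tgt r) (AddMonoidHom.mulRight (E.s r') h) := by
  simp only [AddMonoidHom.mulRight_apply, mul_assoc, tgt, E.comm]

/-- The right `R`-action `(x ⊗ h) · r = x ⊗ h s(r)` on `P ⊗_R H`. -/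
def ract : R → E.Tensor p →+ E.Tensor p :=
  BalTensor.rightAct (fun r => AddMonoidHom.mulRight (p r)) (fun r => AddMonoidHom.mulRight (E.tgt r))
    (fun r => AddMonoidHom.mulRight (E.s r)) E.act_comm

/-- The left `R`-action `r · (h ⊗ h') = h t(r) ⊗ h'` on `H ⊗_R H`. -/
def lact : R → E.Tensor E.s →+ E.Tensor E.s :=
  BalTensor.leftAct (fun r => AddMonoidHom.mulRight (E.tgt r)) (fun r => AddMonoidHom.mulRight (E.s r))
    (fun r => AddMonoidHom.mulRight (E.tgt r)) E.act_comm

/-- `P ⊗_R (H ⊗_R H)`. -/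
abbrev Tensor₃ : Type _ := BalTensor (fun r => AddMonoidHom.mulRight (p r)) E.lact

/-- The left `R`-module `_R H`, with `r · h = h t(r)`. -/
abbrev leftModule : Module R H where
  smul r h := h * E.tgt r
  one_smul h := by
    change h * E.t 1 = h
    rw [map_one, mul_one]
  mul_smul r r' h := by
    change h * E.t (MulOpposite.op r' * MulOpposite.op r) = h * E.t _ * E.t _
    rw [map_mul, mul_assoc]
  smul_zero r := zero_mul _
  smul_add r h h' := add_mul _ _ _
  add_smul r r' h := by
    change h * E.t (MulOpposite.op r + MulOpposite.op r') = h * E.t _ + h * E.t _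
    rw [map_add, mul_add]
  zero_smul h := by
    change h * E.t 0 = 0
    rw [map_zero, mul_zero]

/-- `_R H` is finitely generated projective. -/
def IsLeftFiniteProjective : Prop :=
  letI := E.leftModule
  Module.Finite R H ∧ Module.Projective R H

end SourceTarget

/-- A comultiplication `Δ : H → H ⊗_R H` and a counit `ε : H → R`, both `R`-`R`-bimodule maps. -/
structure RightCoringData (R : Type u) [Ring R] (H : Type v) [Ring H] extends SourceTarget R H where
  comul : H →+ toSourceTarget.Tensor s
  counit : H →+ R
  comul_left : ∀ (r : R) (h : H), comul (h * toSourceTarget.tgt r) = toSourceTarget.lact r (comul h)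
  comul_right : ∀ (r : R) (h : H), comul (h * s r) = toSourceTarget.ract s r (comul h)
  counit_left : ∀ (r : R) (h : H), counit (h * toSourceTarget.tgt r) = r * counit h
  counit_right : ∀ (r : R) (h : H), counit (h * s r) = counit h * r

namespace RightCoringData

variable {R : Type u} [Ring R] {H : Type v} [Ring H] (C : RightCoringData R H)
  {P : Type w} [Ring P] (p : R →+* P)

/-- `id ⊗ ε : P ⊗_R H → P`, `x ⊗ h ↦ x p(ε(h))`. -/
def idCounit : C.Tensor p →+ P :=
  BalTensor.lift
    (AddMonoidHom.mk' (fun x => (AddMonoidHom.mulLeft x).comp ((p : R →+ P).comp C.counit))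
      (fun x x' => by ext h; simp [add_mul]))
    (fun r x h => by
      change x * p r * p (C.counit h) = x * p (C.counit (h * C.tgt r))
      rw [C.counit_left, map_mul, mul_assoc])

/-- `ε ⊗ id : H ⊗_R H → H`, `h ⊗ h' ↦ h' t(ε(h))`. -/
def counitId : C.Tensor C.s →+ H :=
  BalTensor.lift
    (AddMonoidHom.mk' (fun h => AddMonoidHom.mulRight (C.tgt (C.counit h)))
      (fun h h' => by
        ext x
        change x * C.t (MulOpposite.op (C.counit (h + h'))) = x * C.t _ + x * C.t _
        rw [map_add, MulOpposite.op_add, map_add, mul_add]))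
    (fun r h h' => by
      change h' * C.t (MulOpposite.op (C.counit (h * C.s r))) = h' * C.t _ * C.t _
      rw [C.counit_right, MulOpposite.op_mul, map_mul, mul_assoc])

/-- `id ⊗ Δ : P ⊗_R H → P ⊗_R (H ⊗_R H)`. -/
def idComul : C.Tensor p →+ C.Tensor₃ p :=
  BalTensor.map (AddMonoidHom.id P) C.comul (fun _ _ => rfl) (fun r h => C.comul_left r h)

/-- `δ ⊗ id : P ⊗_R H → (P ⊗_R H) ⊗_R H = P ⊗_R (H ⊗_R H)` for a right `R`-linear
`δ : P → P ⊗_R H`. -/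
def coactId (δ : P →+ C.Tensor p) (hδ : ∀ (r : R) (x : P), δ (x * p r) = C.ract p r (δ x)) :
    C.Tensor p →+ C.Tensor₃ p :=
  (BalTensor.assoc (fun r => AddMonoidHom.mulRight (p r)) (fun r => AddMonoidHom.mulRight (C.tgt r))
    (fun r => AddMonoidHom.mulRight (C.s r)) (fun r => AddMonoidHom.mulRight (C.tgt r))
    C.act_comm).comp
  (BalTensor.map δ (AddMonoidHom.id H) (fun r x => hδ r x) (fun _ _ => rfl))

end RightCoringData

/-- A right bialgebroid over `R`. -/
structure RightBialgebroid (R : Type u) [Ring R] (H : Type v) [Ring H] extends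
    RightCoringData R H where
  coassoc : ∀ h : H, toRightCoringData.coactId s comul comul_right (comul h) =
    toRightCoringData.idComul s (comul h)
  counit_id_comul : ∀ h : H, toRightCoringData.counitId (comul h) = h
  id_counit_comul : ∀ h : H, toRightCoringData.idCounit s (comul h) = h
  comul_mem : ∀ h : H, comul h ∈ RingTensor.takeuchi s toSourceTarget.tgt
  comul_one : comul 1 = toSourceTarget.tmul s 1 1
  comul_mul : ∀ g h : H, comul (g * h) =
    RingTensor.takeuchiMul s toSourceTarget.tgt (comul g) ⟨comul h, comul_mem h⟩
  counit_one : counit 1 = 1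
  counit_mul_s : ∀ g h : H, counit (g * h) = counit (s (counit g) * h)
  counit_mul_t : ∀ g h : H, counit (g * h) = counit (toSourceTarget.tgt (counit g) * h)

/-! ### Comodule algebras and Galois extensions -/

/-- The structure of a right `H`-comodule algebra on a ring `A`: an `R`-ring structure `π : R → A` and a
coassociative counital coaction `δ : A → A ⊗_R H`, where `a · r = a π(r)`, which is right `R`-linear and
unital, has values in the Takeuchi product `A ×_R H`, and is multiplicative. -/
structure RightComoduleAlgebra {R : Type u} [Ring R] {H : Type v} [Ring H]
    (𝓗 : RightBialgebroid R H) (A : Type w) [Ring A] where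
  π : R →+* A
  δ : A →+ 𝓗.Tensor π
  δ_right : ∀ (r : R) (a : A), δ (a * π r) = 𝓗.ract π r (δ a)
  coassoc : ∀ a : A, 𝓗.coactId π δ δ_right (δ a) = 𝓗.idComul π (δ a)
  counit : ∀ a : A, 𝓗.idCounit π (δ a) = a
  δ_mem : ∀ a : A, δ a ∈ RingTensor.takeuchi π 𝓗.tgt
  δ_one : δ 1 = 𝓗.tmul π 1 1
  δ_mul : ∀ a a' : A, δ (a * a') = RingTensor.takeuchiMul π 𝓗.tgt (δ a) ⟨δ a', δ_mem a'⟩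

namespace RightComoduleAlgebra

variable {R : Type u} [Ring R] {H : Type v} [Ring H] {𝓗 : RightBialgebroid R H}
  {A : Type w} [Ring A] (𝓐 : RightComoduleAlgebra 𝓗 A)

/-- `a` is a coinvariant: `δ(a) = a ⊗ 1`. -/
def IsCoinvariant (a : A) : Prop := 𝓐.δ a = 𝓗.tmul 𝓐.π a 1

variable {B : Type*} [Ring B] (ρ : B →+* A)

/-- `A ⊗_B A` with respect to `a · b = a ρ(b)` and `b · a = ρ(b) a`. -/
abbrev SelfTensor : Type _ :=
  BalTensor (fun b => AddMonoidHom.mulRight (ρ b)) (fun b => AddMonoidHom.mulLeft (ρ b))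

/-- The Galois map `Γ : A ⊗_B A → A ⊗_R H`, `a ⊗ a' ↦ a a'₍₀₎ ⊗ a'₍₁₎`, when `ρ(B)` consists of
coinvariants. -/
def galoisMap (hρ : ∀ b : B, 𝓐.IsCoinvariant (ρ b)) : SelfTensor ρ →+ 𝓗.Tensor 𝓐.π :=
  BalTensor.lift
    (AddMonoidHom.mk' (fun a => (RingTensor.lmul 𝓐.π 𝓗.tgt a 1).comp 𝓐.δ)
      (fun a a' => by ext x; simp))
    (fun b a a' => by
      change RingTensor.lmul 𝓐.π 𝓗.tgt (a * ρ b) 1 (𝓐.δ a') =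
        RingTensor.lmul 𝓐.π 𝓗.tgt a 1 (𝓐.δ (ρ b * a'))
      have h1 := RingTensor.lmul_mul 𝓐.π 𝓗.tgt a (ρ b) 1 1 (𝓐.δ a')
      rw [mul_one] at h1
      rw [𝓐.δ_mul, hρ b, h1]
      rfl)

/-- `ρ : B → A` is right `H`-Galois with respect to the given comodule algebra structure: the coinvariants
are precisely `ρ(B)` and the Galois map is bijective. -/
def IsGalois : Prop :=
  ∃ hρ : ∀ b : B, 𝓐.IsCoinvariant (ρ b),
    (∀ a : A, 𝓐.IsCoinvariant a → a ∈ ρ.range) ∧ Function.Bijective (𝓐.galoisMap ρ hρ)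

end RightComoduleAlgebra

/-!
Let `T = ρλ` be the endomorphism of the monad on `A` generated by an adjunction `λ ⊣ ρ`. The
bialgebroid is `H = (End T)ᵐᵒᵖ`, and adjunction identifies its elements with the 2-cells `Tρ ⟶ ρ`,
their mates. Composing 2-cells maps `A ⊗_R H`, `H ⊗_R H` and `H ⊗_R H ⊗_R H` to `A`. If `ρλρ ≤ ρ`,
a direct summand diagram yields a finite dual basis of `_R H`, and these maps become injective with
images that can be described explicitly. The structure maps of `H` and the coaction on `A` can then
be prescribed by elements of `A` (`Δ(h)` by `mate(h) μ`, `δ(a)` by `μ T(a)`), and every axiom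
reduces to an identity between 2-cells, which follows from the monad laws and naturality. The Galois
map becomes the isomorphism `A ⊗_B A ≅ A` which comes from the isomorphism `_B A ≅ _B B`.

Conversely, `_B A ≅ _B B` is equivalent to the existence of a left adjoint `λ`. The inverse of the
Galois map carries a dual basis of `_R H` to a dual basis of the left `A`-module `A ⊗_B A ≅ A`, and
its coordinates and elements are 2-cells `ρ ⟶ ρλρ` and `ρλρ ⟶ ρ` exhibiting `ρλρ ≤ ρ`. Since left
adjoints of `ρ` are isomorphic, the condition does not depend on the choice of `λ`.
-/

section TwoCellCalculus

variable {A B C : Type*} [Ring A] [Ring B] [Ring C]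

namespace IsIntertwiner

variable {α β γ : A →+* B} {x y : B}

theorem mul (hy : IsIntertwiner β γ y) (hx : IsIntertwiner α β x) :
    IsIntertwiner α γ (y * x) := fun a => by
  rw [mul_assoc, hx, ← mul_assoc, hy, mul_assoc]

theorem map (κ : B →+* C) (hx : IsIntertwiner α β x) :
    IsIntertwiner (κ.comp α) (κ.comp β) (κ x) := fun a => by
  simp only [RingHom.comp_apply, ← map_mul, hx a]

theorem comp (hx : IsIntertwiner α β x) (κ : C →+* A) :
    IsIntertwiner (α.comp κ) (β.comp κ) x := fun c => hx (κ c)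

end IsIntertwiner

namespace IsSummandOf

variable {α β γ : A →+* B}

theorem of_sum_eq_one {ι : Type*} [Fintype ι] {a b : ι → B}
    (hb : ∀ i, IsIntertwiner α β (b i)) (ha : ∀ i, IsIntertwiner β α (a i))
    (hab : ∑ i, a i * b i = 1) : IsSummandOf α β := by
  let e := (Fintype.equivFin ι).symm
  exact ⟨_, a ∘ e, b ∘ e, fun i => hb (e i), fun i => ha (e i),
    (e.sum_comp fun i => a i * b i).trans hab⟩

theorem trans (hαβ : IsSummandOf α β) (hβγ : IsSummandOf β γ) : IsSummandOf α γ := by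
  obtain ⟨m, a, b, hb, ha, hab⟩ := hαβ
  obtain ⟨n, a', b', hb', ha', hab'⟩ := hβγ
  refine of_sum_eq_one (ι := Fin m × Fin n) (a := fun i => a i.1 * a' i.2)
    (b := fun i => b' i.2 * b i.1) (fun i => (hb' i.2).mul (hb i.1))
    (fun i => (ha i.1).mul (ha' i.2)) ?_
  calc ∑ i : Fin m × Fin n, a i.1 * a' i.2 * (b' i.2 * b i.1)
      = ∑ i, a i * (∑ j, a' j * b' j) * b i := by
        simp only [Fintype.sum_prod_type, Finset.mul_sum, Finset.sum_mul, mul_assoc]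
    _ = 1 := by simp only [hab', mul_one, hab]

theorem map (κ : B →+* C) (h : IsSummandOf α β) : IsSummandOf (κ.comp α) (κ.comp β) := by
  obtain ⟨n, a, b, hb, ha, hab⟩ := h
  refine ⟨n, fun i => κ (a i), fun i => κ (b i), fun i => (hb i).map κ, fun i => (ha i).map κ, ?_⟩
  simp only [← map_mul, ← map_sum, hab, map_one]

theorem comp (h : IsSummandOf α β) (κ : C →+* A) : IsSummandOf (α.comp κ) (β.comp κ) := by
  obtain ⟨n, a, b, hb, ha, hab⟩ := h
  exact ⟨n, a, b, fun i => (hb i).comp κ, fun i => (ha i).comp κ, hab⟩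

end IsSummandOf

/-- An adjunction `λ ⊣ ρ` in the 2-category of rings with chosen counit `ε : λρ ⟶ id_B` and unit
`η : id_A ⟶ ρλ`, the data whose existence is asserted by `IsLeftAdjoint`. -/
structure RingAdjunction (lam : A →+* B) (ρ : B →+* A) where
  ε : B
  η : A
  isIntertwiner_ε : IsIntertwiner (lam.comp ρ) (RingHom.id B) ε
  isIntertwiner_η : IsIntertwiner (RingHom.id A) (ρ.comp lam) η
  ρ_ε_mul_η : ρ ε * η = 1
  ε_mul_lam_η : ε * lam η = 1

theorem isLeftAdjoint_iff_nonempty_ringAdjunction {lam : A →+* B} {ρ : B →+* A} :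
    IsLeftAdjoint lam ρ ↔ Nonempty (RingAdjunction lam ρ) :=
  ⟨fun ⟨ε, η, hε, hη, h, h'⟩ => ⟨⟨ε, η, hε, hη, h, h'⟩⟩,
    fun ⟨⟨ε, η, hε, hη, h, h'⟩⟩ => ⟨ε, η, hε, hη, h, h'⟩⟩

namespace RingAdjunction

variable {lam lam' : A →+* B} {ρ : B →+* A} (D : RingAdjunction lam ρ)

theorem ε_mul (b : B) : D.ε * lam (ρ b) = b * D.ε := D.isIntertwiner_ε b

theorem η_mul (a : A) : D.η * a = ρ (lam a) * D.η := D.isIntertwiner_η a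

theorem isLeftRegularHom (D : RingAdjunction lam ρ) : IsLeftRegularHom ρ :=
  ⟨{  toFun := fun b => ρ b * D.η
      invFun := fun a => D.ε * lam a
      left_inv := fun b => by
        beta_reduce
        rw [map_mul, ← mul_assoc, D.ε_mul, mul_assoc, D.ε_mul_lam_η, mul_one]
      right_inv := fun a => by
        beta_reduce
        rw [map_mul, mul_assoc, ← D.η_mul, ← mul_assoc, D.ρ_ε_mul_η, one_mul]
      map_add' := fun b b' => by rw [map_add, add_mul] },
    fun b b' => show ρ (b * b') * D.η = ρ b * (ρ b' * D.η) by rw [map_mul, mul_assoc]⟩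

/-- The canonical 2-cell `λ ⟶ λ'` between two left adjoints of `ρ`. -/
def comparison (D : RingAdjunction lam ρ) (D' : RingAdjunction lam' ρ) : B := D.ε * lam D'.η

theorem isIntertwiner_comparison (D' : RingAdjunction lam' ρ) :
    IsIntertwiner lam lam' (D.comparison D') := fun a => by
  rw [comparison, mul_assoc, ← map_mul, D'.η_mul, map_mul, ← mul_assoc, D.ε_mul, mul_assoc]

theorem comparison_mul_comparison (D' : RingAdjunction lam' ρ) :
    D.comparison D' * D'.comparison D = 1 :=
  calc D.comparison D' * (D'.ε * lam' D.η)
      = D.ε * (lam D'.η * D'.ε) * lam' D.η := by simp only [comparison, mul_assoc]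
    _ = D'.ε * lam' (ρ (D.ε * lam D'.η)) * lam' D.η := by
      rw [D'.ε_mul]; simp only [mul_assoc]
    _ = D'.ε * lam' (ρ D.ε * (ρ (lam D'.η) * D.η)) := by simp only [map_mul, mul_assoc]
    _ = 1 := by rw [← D.η_mul, ← mul_assoc, D.ρ_ε_mul_η, one_mul, D'.ε_mul_lam_η]

end RingAdjunction

namespace IsLeftAdjoint

variable {lam lam' : A →+* B} {ρ : B →+* A}

theorem isSummandOf (h : IsLeftAdjoint lam ρ) (h' : IsLeftAdjoint lam' ρ) :
    IsSummandOf lam' lam := by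
  obtain ⟨D⟩ := isLeftAdjoint_iff_nonempty_ringAdjunction.1 h
  obtain ⟨D'⟩ := isLeftAdjoint_iff_nonempty_ringAdjunction.1 h'
  exact IsSummandOf.of_sum_eq_one (ι := Unit) (fun _ => D'.isIntertwiner_comparison D)
    (fun _ => D.isIntertwiner_comparison D')
    ((Fintype.sum_unique _).trans (D.comparison_mul_comparison D'))

theorem comp_comp_isSummandOf (h : IsLeftAdjoint lam ρ) (h' : IsLeftAdjoint lam' ρ)
    (hρ : IsSummandOf ((ρ.comp lam).comp ρ) ρ) : IsSummandOf ((ρ.comp lam').comp ρ) ρ :=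
  (((h.isSummandOf h').map ρ).comp ρ).trans hρ

end IsLeftAdjoint

theorem IsLeftRegularHom.exists_isLeftAdjoint {ρ : B →+* A} (h : IsLeftRegularHom ρ) :
    ∃ lam : A →+* B, IsLeftAdjoint lam ρ := by
  obtain ⟨f, hf⟩ := h
  have ρ_mul : ∀ b, ρ b * f 1 = f b := fun b => by rw [← hf, mul_one]
  have ρ_symm_mul : ∀ a, ρ (f.symm a) * f 1 = a := fun a => by rw [ρ_mul, f.apply_symm_apply]
  have ext : ∀ {b b'}, ρ b * f 1 = ρ b' * f 1 → b = b' := fun hb =>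
    f.injective (by rwa [ρ_mul, ρ_mul] at hb)
  let lam : A →+* B :=
    { toFun := fun a => f.symm (f 1 * a)
      map_one' := by rw [mul_one, f.symm_apply_apply]
      map_zero' := by rw [mul_zero, map_zero]
      map_add' := fun a a' => by rw [mul_add, map_add]
      map_mul' := fun a a' => ext (by
        rw [map_mul ρ, ρ_symm_mul, mul_assoc, ρ_symm_mul, ← mul_assoc, ← mul_assoc, ρ_symm_mul]) }
  have ρ_lam_mul : ∀ a, ρ (lam a) * f 1 = f 1 * a := fun a => ρ_symm_mul _
  refine ⟨lam, f.symm 1, f 1, fun b => ext ?_, fun a => (ρ_lam_mul a).symm, ρ_symm_mul 1, ext ?_⟩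
  · change ρ (f.symm 1 * lam (ρ b)) * f 1 = ρ (b * f.symm 1) * f 1
    rw [map_mul, mul_assoc, ρ_lam_mul, ← mul_assoc, ρ_symm_mul, one_mul, map_mul, mul_assoc,
      ρ_symm_mul, mul_one]
  · rw [map_mul, mul_assoc, ρ_lam_mul, ← mul_assoc, ρ_symm_mul, one_mul, map_one ρ, one_mul]

theorem isLeftRegularHom_iff_exists_isLeftAdjoint {ρ : B →+* A} :
    IsLeftRegularHom ρ ↔ ∃ lam : A →+* B, IsLeftAdjoint lam ρ :=
  ⟨IsLeftRegularHom.exists_isLeftAdjoint, fun ⟨_, h⟩ =>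
    let ⟨D⟩ := isLeftAdjoint_iff_nonempty_ringAdjunction.1 h
    D.isLeftRegularHom⟩

end TwoCellCalculus

section BialgebroidCalculus

namespace BalTensor

variable {R M N : Type*} [AddCommGroup M] [AddCommGroup N] {f : R → M →+ M} {g : R → N →+ N}

theorem induction_on {motive : BalTensor f g → Prop} (z : BalTensor f g)
    (mk : ∀ m n, motive (mk f g m n)) (add : ∀ x y, motive x → motive y → motive (x + y)) :
    motive z := by
  obtain ⟨w, rfl⟩ := QuotientAddGroup.mk'_surjective (balancedRel f g) z
  induction w using TensorProduct.induction_on with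
  | zero => rw [← TensorProduct.zero_tmul M (0 : N)]; exact mk 0 0
  | tmul m n => exact mk m n
  | add x y hx hy => rw [map_add]; exact add _ _ hx hy

end BalTensor

namespace SourceTarget

variable {R : Type*} [Ring R] {H : Type*} [Ring H] (S : SourceTarget R H)

theorem ract_tmul {P : Type*} [Ring P] (p : R →+* P) (r : R) (x : P) (h : H) :
    S.ract p r (S.tmul p x h) = S.tmul p x (h * S.s r) := rfl

/-- A finite dual basis of the left `R`-module `_R H`, where `r · h = h t(r)`. -/
structure DualBasis (ι : Type*) [Fintype ι] where
  elem : ι → H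
  coord : ι → H →+ R
  coord_mul_tgt : ∀ i r h, coord i (h * S.tgt r) = r * coord i h
  sum_elem_mul_tgt : ∀ h, ∑ i, elem i * S.tgt (coord i h) = h

variable {S}

theorem IsLeftFiniteProjective.exists_dualBasis (hS : S.IsLeftFiniteProjective) :
    ∃ n : ℕ, Nonempty (S.DualBasis (Fin n)) := by
  let _ := S.leftModule
  obtain ⟨hfin, hproj⟩ := hS
  obtain ⟨n, f, g, -, -, hfg⟩ := Module.Finite.exists_comp_eq_id_of_projective R H
  let coord : Fin n → H →ₗ[R] R := fun i => LinearMap.proj i ∘ₗ g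
  exact ⟨n, ⟨{
    elem := fun i => f fun j => if i = j then 1 else 0
    coord := fun i => (coord i).toAddMonoidHom
    coord_mul_tgt := fun i => (coord i).map_smul
    sum_elem_mul_tgt := fun h =>
      (LinearMap.pi_apply_eq_sum_univ f (g h)).symm.trans (LinearMap.congr_fun hfg h) }⟩⟩

theorem DualBasis.isLeftFiniteProjective {ι : Type*} [Fintype ι] (𝓑 : S.DualBasis ι) :
    S.IsLeftFiniteProjective := by
  let _ := S.leftModule
  let f : (ι → R) →ₗ[R] H := Fintype.linearCombination R 𝓑.elem
  let g : H →ₗ[R] (ι → R) := LinearMap.pi fun i =>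
    { toFun := 𝓑.coord i
      map_add' := map_add (𝓑.coord i)
      map_smul' := 𝓑.coord_mul_tgt i }
  have hfg : f ∘ₗ g = LinearMap.id := LinearMap.ext 𝓑.sum_elem_mul_tgt
  exact ⟨Module.Finite.of_surjective f fun h => ⟨g h, LinearMap.congr_fun hfg h⟩,
    Module.Projective.of_split g f hfg⟩

section Coordinates

variable {P : Type*} [Ring P] (p : R →+* P)

/-- The map `x ⊗ h ↦ x p(φ(h))` induced by a left `R`-linear functional `φ` on `H`. -/
def coordMap (φ : H →+ R) (hφ : ∀ r h, φ (h * S.tgt r) = r * φ h) : S.Tensor p →+ P :=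
  BalTensor.lift (AddMonoidHom.mul.compl₂ ((p : R →+ P).comp φ)) fun r x h => by
    change x * p r * p (φ h) = x * p (φ (h * S.tgt r))
    rw [hφ, map_mul, mul_assoc]

/-- The map `x ⊗ (g ⊗ h) ↦ x ⊗ g s(φ(h))` induced by a left `R`-linear functional `φ` on `H`. -/
def coordMap₃ (φ : H →+ R) (hφ : ∀ r h, φ (h * S.tgt r) = r * φ h) :
    S.Tensor₃ p →+ S.Tensor p :=
  BalTensor.map (AddMonoidHom.id P) (coordMap S.s φ hφ) (fun _ _ => rfl) fun r z => by
    induction z using BalTensor.induction_on with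
    | mk g h => exact S.act_comm r (φ h) g
    | add z w hz hw => simp only [map_add, hz, hw]

namespace DualBasis

variable {ι : Type*} [Fintype ι] (𝓑 : S.DualBasis ι)

theorem sum_coordMap (z : S.Tensor p) :
    ∑ i, S.tmul p (coordMap p (𝓑.coord i) (𝓑.coord_mul_tgt i) z) (𝓑.elem i) = z := by
  induction z using BalTensor.induction_on with
  | mk x h =>
    calc ∑ i, S.tmul p (x * p (𝓑.coord i h)) (𝓑.elem i)
        = ∑ i, S.tmul p x (𝓑.elem i * S.tgt (𝓑.coord i h)) :=
          Finset.sum_congr rfl fun i _ => BalTensor.mk_balanced _ _ (𝓑.coord i h) x (𝓑.elem i)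
      _ = S.tmul p x h := by rw [← map_sum, 𝓑.sum_elem_mul_tgt]
  | add z w hz hw =>
    simp only [tmul, RingTensor.tmul] at hz hw ⊢
    simp only [map_add, AddMonoidHom.add_apply, Finset.sum_add_distrib, hz, hw]

theorem tensor_ext {z w : S.Tensor p}
    (h : ∀ i, coordMap p (𝓑.coord i) (𝓑.coord_mul_tgt i) z =
      coordMap p (𝓑.coord i) (𝓑.coord_mul_tgt i) w) : z = w := by
  rw [← 𝓑.sum_coordMap p z, ← 𝓑.sum_coordMap p w]
  exact Finset.sum_congr rfl fun i _ => by rw [h i]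

theorem tensor₃_ext {z w : S.Tensor₃ p}
    (h : ∀ i, coordMap₃ p (𝓑.coord i) (𝓑.coord_mul_tgt i) z =
      coordMap₃ p (𝓑.coord i) (𝓑.coord_mul_tgt i) w) : z = w := by
  let insert (i : ι) : S.Tensor p →+ S.Tensor₃ p :=
    BalTensor.map (AddMonoidHom.id P) ((BalTensor.mk _ _).flip (𝓑.elem i)) (fun _ _ => rfl)
      fun _ _ => rfl
  have sum_insert (z : S.Tensor₃ p) :
      ∑ i, insert i (coordMap₃ p (𝓑.coord i) (𝓑.coord_mul_tgt i) z) = z := by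
    induction z using BalTensor.induction_on with
    | mk x z =>
      exact (map_sum (BalTensor.mk _ S.lact x) _ _).symm.trans
        (congrArg (BalTensor.mk _ S.lact x) (𝓑.sum_coordMap S.s z))
    | add z w hz hw => simp only [map_add, Finset.sum_add_distrib, hz, hw]
  rw [← sum_insert z, ← sum_insert w]
  exact Finset.sum_congr rfl fun i _ => by rw [h i]

end DualBasis

end Coordinates

end SourceTarget

end BialgebroidCalculus

section EndomorphismBialgebroid

variable {A : Type v} {B : Type u} [Ring A] [Ring B] {lam : A →+* B} {ρ : B →+* A}

theorem endRing.coe_mul_apply (r : endRing ρ) (b : B) : (r : A) * ρ b = ρ b * r := r.2 b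

theorem endRing_le_endRing_comp {C : Type*} [Ring C] (κ : C →+* B) :
    endRing ρ ≤ endRing (ρ.comp κ) := fun _ hr => IsIntertwiner.comp hr κ

namespace RingAdjunction

/-- The underlying endomorphism `T = ρλ` of the monad on `A` generated by `λ ⊣ ρ`. -/
def T (_ : RingAdjunction lam ρ) : A →+* A := ρ.comp lam

variable (D : RingAdjunction lam ρ)

/-- The multiplication `TT ⟶ T` of the monad generated by `λ ⊣ ρ`; as an element of `A` it is also
the 2-cell `ρε : Tρ ⟶ ρ`. -/
def μ : A := ρ D.ε

theorem T_mul_η (a : A) : D.T a * D.η = D.η * a := (D.η_mul a).symm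

theorem μ_mul_η : D.μ * D.η = 1 := D.ρ_ε_mul_η

theorem μ_mul_T_η : D.μ * D.T D.η = 1 := by
  simp only [μ, T, RingHom.comp_apply, ← map_mul, D.ε_mul_lam_η, map_one]

theorem μ_mul_T_apply (b : B) : D.μ * D.T (ρ b) = ρ b * D.μ := by
  simp only [μ, T, RingHom.comp_apply, ← map_mul, D.ε_mul]

theorem μ_mul_T_T (a : A) : D.μ * D.T (D.T a) = D.T a * D.μ := D.μ_mul_T_apply (lam a)

theorem μ_mul_T_μ : D.μ * D.T D.μ = D.μ * D.μ := D.μ_mul_T_apply D.ε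

theorem isIntertwiner_μ : IsIntertwiner (D.T.comp D.T) D.T D.μ := D.μ_mul_T_T

theorem coe_mul_μ (r : endRing ρ) : (r : A) * D.μ = D.μ * r := endRing.coe_mul_apply r D.ε

theorem coe_mul_T (r : endRing ρ) (a : A) : (r : A) * D.T a = D.T a * r :=
  endRing.coe_mul_apply r (lam a)

theorem isIntertwiner_η_comp : IsIntertwiner ρ (D.T.comp ρ) D.η := fun b => D.η_mul (ρ b)

/-- The bialgebroid of the adjunction. Its product is opposite to vertical composition of
2-cells. -/
abbrev H : Type v := (endRing D.T)ᵐᵒᵖ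

/-- The underlying 2-cell `T ⟶ T` of an element of the bialgebroid. -/
def val : D.H →+ A := (endRing D.T).subtype.toAddMonoidHom.comp
  (MulOpposite.opAddEquiv.symm : D.H ≃+ endRing D.T).toAddMonoidHom

theorem val_mul (g h : D.H) : D.val (g * h) = D.val h * D.val g := rfl

theorem val_one : D.val 1 = 1 := rfl

theorem val_injective : Function.Injective D.val :=
  Subtype.val_injective.comp MulOpposite.unop_injective

theorem val_mul_T (h : D.H) (a : A) : D.val h * D.T a = D.T a * D.val h := h.unop.2 a

/-- The 2-cell `Tρ ⟶ ρ` adjoint to a 2-cell `T ⟶ T`. -/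
def mate : D.H →+ A := (AddMonoidHom.mulLeft D.μ).comp D.val

theorem mate_apply (h : D.H) : D.mate h = D.μ * D.val h := rfl

theorem mate_one : D.mate 1 = D.μ := mul_one _

theorem mate_mul (g h : D.H) : D.mate (g * h) = D.mate h * D.val g := by
  rw [mate_apply, mate_apply, val_mul, mul_assoc]

theorem mate_mul_T_apply (h : D.H) (b : B) : D.mate h * D.T (ρ b) = ρ b * D.mate h := by
  rw [mate_apply, mul_assoc, val_mul_T, ← mul_assoc, μ_mul_T_apply, mul_assoc]

theorem isIntertwiner_mate (h : D.H) : IsIntertwiner (D.T.comp ρ) ρ (D.mate h) :=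
  D.mate_mul_T_apply h

theorem mate_mul_T_η (h : D.H) : D.mate h * D.T D.η = D.val h := by
  rw [mate_apply, mul_assoc, val_mul_T, ← mul_assoc, μ_mul_T_η, one_mul]

theorem mate_injective : Function.Injective D.mate := fun g h hgh =>
  D.val_injective (by rw [← mate_mul_T_η, hgh, mate_mul_T_η])

/-- The element of the bialgebroid with a given mate. -/
def ofMate (x : A) (hx : IsIntertwiner (D.T.comp ρ) ρ x) : D.H :=
  MulOpposite.op ⟨x * D.T D.η, fun a => by
    have hxa : x * D.T (D.T a) = D.T a * x := hx (lam a)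
    rw [mul_assoc, ← map_mul, ← D.T_mul_η, map_mul, ← mul_assoc, hxa, mul_assoc]⟩

theorem mate_ofMate (x : A) (hx : IsIntertwiner (D.T.comp ρ) ρ x) : D.mate (D.ofMate x hx) = x :=
  calc D.μ * (x * D.T D.η) = x * D.T D.μ * D.T D.η := by
        rw [← mul_assoc]; exact congrArg (· * _) (hx D.ε).symm
    _ = x := by rw [mul_assoc, ← map_mul, μ_mul_η, map_one, mul_one]

/-- The source map of the bialgebroid, the image under `T` of 2-cells `ρ ⟶ ρ` read through
mates. -/
def source (r : endRing ρ) : D.H :=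
  D.ofMate (D.μ * D.T r) fun b => by
    rw [RingHom.comp_apply, mul_assoc, ← map_mul, endRing.coe_mul_apply, map_mul, ← mul_assoc,
      μ_mul_T_apply, mul_assoc]

theorem mate_source (r : endRing ρ) : D.mate (D.source r) = D.μ * D.T r := D.mate_ofMate _ _

theorem mate_mul_source (g : D.H) (r : endRing ρ) :
    D.mate (g * D.source r) = D.mate g * D.T r := by
  rw [mate_mul, mate_source, mul_assoc, ← val_mul_T, ← mul_assoc, ← mate_apply]

/-- The target map of the bialgebroid, which whiskers 2-cells `ρ ⟶ ρ` with `λ`. -/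
def target : (endRing ρ)ᵐᵒᵖ →+* D.H :=
  (Subring.inclusion (endRing_le_endRing_comp lam)).op

theorem mate_mul_target (g : D.H) (r : endRing ρ) :
    D.mate (g * D.target (MulOpposite.op r)) = r * D.mate g :=
  calc D.mate (g * D.target (MulOpposite.op r)) = D.μ * r * D.val g := D.mate_mul _ _
    _ = r * D.mate g := by rw [← coe_mul_μ, mul_assoc, ← mate_apply]

/-- The source and target maps `End ρ → H`. -/
def sourceTarget : SourceTarget (endRing ρ) D.H where
  s :=
    { toFun := D.source
      map_one' := D.mate_injective (by
        rw [mate_source, mate_one, OneMemClass.coe_one, map_one, mul_one])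
      map_zero' := D.mate_injective (by
        rw [mate_source, ZeroMemClass.coe_zero, map_zero, mul_zero, map_zero])
      map_add' := fun r r' => D.mate_injective (by
        simp only [map_add, mate_source, AddMemClass.coe_add, mul_add])
      map_mul' := fun r r' => D.mate_injective (by
        simp only [mate_mul_source, mate_source, MulMemClass.coe_mul, map_mul, mul_assoc]) }
  t := D.target
  comm := fun r r' => D.mate_injective (by
    change D.mate (D.source r * D.target (.op r'.unop)) = D.mate (D.target r' * D.source r)
    have mate_target : D.mate (D.target r') = r'.unop * D.μ := by
      rw [← mate_one, ← D.mate_mul_target, one_mul]; rfl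
    rw [mate_mul_target, mate_mul_source, mate_source, mate_target, mul_assoc])

theorem mate_mul_s (g : D.H) (r : endRing ρ) :
    D.mate (g * D.sourceTarget.s r) = D.mate g * D.T r := D.mate_mul_source g r

theorem mate_mul_tgt (g : D.H) (r : endRing ρ) :
    D.mate (g * D.sourceTarget.tgt r) = r * D.mate g := D.mate_mul_target g r

theorem val_tgt (r : endRing ρ) : D.val (D.sourceTarget.tgt r) = r := rfl

/-- Composition of mates with a fixed 2-cell `a : ρ ⟶ Tρ`, which gives a left linear functional on
the bialgebroid. -/
def pairing (a : A) (ha : IsIntertwiner ρ (D.T.comp ρ) a) : D.H →+ endRing ρ :=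
  ((AddMonoidHom.mulRight a).comp D.mate).codRestrict (endRing ρ) fun h =>
    (D.isIntertwiner_mate h).mul ha

theorem coe_pairing {a : A} (ha : IsIntertwiner ρ (D.T.comp ρ) a) (h : D.H) :
    (D.pairing a ha h : A) = D.mate h * a := rfl

theorem pairing_mul_tgt {a : A} (ha : IsIntertwiner ρ (D.T.comp ρ) a) (r : endRing ρ) (h : D.H) :
    D.pairing a ha (h * D.sourceTarget.tgt r) = r * D.pairing a ha h :=
  Subtype.ext (by rw [MulMemClass.coe_mul, coe_pairing, coe_pairing, mate_mul_tgt, mul_assoc])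

/-- The counit `h ↦ mate(h) η` of the bialgebroid. -/
def counit : D.H →+ endRing ρ := D.pairing D.η D.isIntertwiner_η_comp

theorem coe_counit (h : D.H) : (D.counit h : A) = D.mate h * D.η := rfl

theorem counit_one : D.counit 1 = 1 :=
  Subtype.ext (by rw [coe_counit, mate_one, μ_mul_η, OneMemClass.coe_one])

theorem counit_mul_s (h : D.H) (r : endRing ρ) :
    D.counit (h * D.sourceTarget.s r) = D.counit h * r :=
  Subtype.ext (by
    rw [MulMemClass.coe_mul, coe_counit, coe_counit, mate_mul_s, mul_assoc, T_mul_η, mul_assoc])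

theorem counit_mul_congr {g g' : D.H} (hg : D.val g * D.η = D.val g' * D.η) (h : D.H) :
    D.counit (g * h) = D.counit (g' * h) :=
  Subtype.ext (by rw [coe_counit, coe_counit, mate_mul, mate_mul, mul_assoc, hg, mul_assoc])

theorem coe_counit_mul_η (g : D.H) : D.counit g * D.η = D.val g * D.η := by
  rw [coe_counit, mul_assoc, ← T_mul_η, ← mul_assoc, mate_mul_T_η]

theorem counit_source_counit_mul (g h : D.H) :
    D.counit (D.sourceTarget.s (D.counit g) * h) = D.counit (g * h) := by
  refine D.counit_mul_congr ?_ h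
  calc D.val (D.source (D.counit g)) * D.η
      = D.μ * D.T (D.counit g) * D.T D.η * D.η := by rw [← mate_mul_T_η, mate_source]
    _ = D.val g * D.η := by
      rw [mul_assoc, T_mul_η, mul_assoc, ← mul_assoc _ D.η, T_mul_η, ← mul_assoc, ← mul_assoc,
        μ_mul_η, one_mul, coe_counit_mul_η]

theorem counit_tgt_counit_mul (g h : D.H) :
    D.counit (D.sourceTarget.tgt (D.counit g) * h) = D.counit (g * h) :=
  D.counit_mul_congr (D.coe_counit_mul_η g) h

end RingAdjunction

/-- An additive embedding of an `R`-ring `p : R → P` in a ring containing `R` which turns right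
multiplication by `p(r)` into right multiplication by the image of `r` under a ring endomorphism.
It serves to treat `A ⊗_R H` and `H ⊗_R H` uniformly. -/
structure TwistedEmbedding (R : Subring A) {P : Type w} [Ring P] (p : R →+* P) where
  emb : P →+ A
  twist : A →+* A
  emb_mul : ∀ x r, emb (x * p r) = emb x * twist r
  injective : Function.Injective emb

/-- The identity embedding of `A`, regarded as an `R`-ring through the inclusion. -/
def TwistedEmbedding.ofSubtype (R : Subring A) : TwistedEmbedding R R.subtype where
  emb := AddMonoidHom.id A
  twist := RingHom.id A
  emb_mul _ _ := rfl
  injective := Function.injective_id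

namespace RingAdjunction

variable (D : RingAdjunction lam ρ)

/-- The embedding `h ↦ mate(h)` of the bialgebroid in `A`, twisted by `T`. -/
def mateEmbedding : TwistedEmbedding (endRing ρ) D.sourceTarget.s where
  emb := D.mate
  twist := D.T
  emb_mul := D.mate_mul_s
  injective := D.mate_injective

section Evaluation

variable {P : Type w} [Ring P] {p : endRing ρ →+* P} (F : TwistedEmbedding (endRing ρ) p)

/-- The evaluation `x ⊗ h ↦ emb(x) twist(mate(h))`. -/
def eval : D.sourceTarget.Tensor p →+ A :=
  BalTensor.lift ((AddMonoidHom.mul.compl₂ ((F.twist : A →+ A).comp D.mate)).comp F.emb)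
    fun r x h => by
      change F.emb (x * p r) * F.twist (D.mate h) =
        F.emb x * F.twist (D.mate (h * D.sourceTarget.tgt r))
      rw [F.emb_mul, mate_mul_tgt, map_mul, mul_assoc]

theorem eval_tmul (x : P) (h : D.H) :
    D.eval F (D.sourceTarget.tmul p x h) = F.emb x * F.twist (D.mate h) := rfl

theorem eval_ract (r : endRing ρ) (z : D.sourceTarget.Tensor p) :
    D.eval F (D.sourceTarget.ract p r z) = D.eval F z * F.twist (D.T r) := by
  induction z using BalTensor.induction_on with
  | mk x h => rw [SourceTarget.ract_tmul, eval_tmul, eval_tmul, mate_mul_s, map_mul, mul_assoc]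
  | add z w hz hw => simp only [map_add, add_mul, hz, hw]

theorem emb_coordMap {a : A} (ha : IsIntertwiner ρ (D.T.comp ρ) a)
    (z : D.sourceTarget.Tensor p) :
    F.emb (SourceTarget.coordMap p (D.pairing a ha) (D.pairing_mul_tgt ha) z) =
      D.eval F z * F.twist a := by
  induction z using BalTensor.induction_on with
  | mk x h =>
    calc F.emb (x * p (D.pairing a ha h)) = F.emb x * F.twist (D.mate h * a) := F.emb_mul _ _
      _ = D.eval F (D.sourceTarget.tmul p x h) * F.twist a := by
        rw [eval_tmul, map_mul, mul_assoc]
  | add z w hz hw => simp only [map_add, add_mul, hz, hw]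

/-- The evaluation `g ⊗ h ↦ mate(g) T(mate(h))` on `H ⊗_R H`. -/
abbrev evalH : D.sourceTarget.Tensor D.sourceTarget.s →+ A := D.eval D.mateEmbedding

/-- The evaluation `a ⊗ h ↦ a mate(h)` on `A ⊗_R H`. -/
abbrev evalA : D.sourceTarget.Tensor (endRing ρ).subtype →+ A :=
  D.eval (TwistedEmbedding.ofSubtype (endRing ρ))

theorem evalH_lact (r : endRing ρ) (z : D.sourceTarget.Tensor D.sourceTarget.s) :
    D.evalH (D.sourceTarget.lact r z) = r * D.evalH z := by
  induction z using BalTensor.induction_on with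
  | mk g h =>
    calc D.mate (g * D.sourceTarget.tgt r) * D.T (D.mate h)
        = r * (D.mate g * D.T (D.mate h)) := by rw [mate_mul_tgt, mul_assoc]
  | add z w hz hw => simp only [map_add, mul_add, hz, hw]

/-- The evaluation `x ⊗ (g ⊗ h) ↦ emb(x) twist(mate(g) T(mate(h)))`. -/
def eval₃ : D.sourceTarget.Tensor₃ p →+ A :=
  BalTensor.lift
    ((AddMonoidHom.mul.compl₂ ((F.twist : A →+ A).comp (D.evalH))).comp F.emb)
    fun r x z => by
      change F.emb (x * p r) * F.twist (D.evalH z) =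
        F.emb x * F.twist (D.evalH (D.sourceTarget.lact r z))
      rw [F.emb_mul, evalH_lact, map_mul, mul_assoc]

theorem eval_coordMap₃ {a : A} (ha : IsIntertwiner ρ (D.T.comp ρ) a)
    (z : D.sourceTarget.Tensor₃ p) :
    D.eval F (SourceTarget.coordMap₃ p (D.pairing a ha) (D.pairing_mul_tgt ha) z) =
      D.eval₃ F z * F.twist (D.T a) := by
  induction z using BalTensor.induction_on with
  | mk x z =>
    calc F.emb x * F.twist (D.mate (SourceTarget.coordMap _ _ _ z))
        = F.emb x * F.twist (D.evalH z * D.T a) :=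
          congrArg (F.emb x * F.twist ·) (D.emb_coordMap D.mateEmbedding ha z)
      _ = F.emb x * F.twist (D.evalH z) * F.twist (D.T a) := by
          rw [map_mul, mul_assoc]
  | add z w hz hw => simp only [map_add, add_mul, hz, hw]

theorem eval₃_assocAux (z : D.sourceTarget.Tensor p) (h : D.H) :
    D.eval₃ F (BalTensor.assocAux _ _ _ _ D.sourceTarget.act_comm z h) =
      D.eval F z * F.twist (D.T (D.mate h)) := by
  induction z using BalTensor.induction_on with
  | mk x g =>
    calc F.emb x * F.twist (D.mate g * D.T (D.mate h))
        = F.emb x * F.twist (D.mate g) * F.twist (D.T (D.mate h)) := by rw [map_mul, mul_assoc]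
  | add z w hz hw =>
    rw [map_add, AddMonoidHom.add_apply, map_add, add_mul]
    exact (map_add (D.eval₃ F) _ _).trans (congrArg₂ _ hz hw)

end Evaluation

theorem evalH_lmul (g h : D.H) (z : D.sourceTarget.Tensor D.sourceTarget.s) :
    D.evalH (RingTensor.lmul D.sourceTarget.s D.sourceTarget.tgt g h z) =
      D.evalH z * (D.val g * D.T (D.val h)) := by
  induction z using BalTensor.induction_on with
  | mk g' h' =>
    calc D.mate (g * g') * D.T (D.mate (h * h'))
        = D.mate g' * (D.val g * D.T (D.mate h')) * D.T (D.val h) := by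
          simp only [mate_mul, map_mul, mul_assoc]
      _ = D.mate g' * D.T (D.mate h') * (D.val g * D.T (D.val h)) := by
          simp only [val_mul_T, mul_assoc]
  | add z w hz hw => simp only [map_add, add_mul, hz, hw]

theorem evalA_lmul (a : A) (h : D.H) (z : D.sourceTarget.Tensor (endRing ρ).subtype) :
    D.evalA (RingTensor.lmul (endRing ρ).subtype D.sourceTarget.tgt a h z) =
      a * D.evalA z * D.val h := by
  induction z using BalTensor.induction_on with
  | mk a' h' =>
    calc a * a' * D.mate (h * h') = a * (a' * D.mate h') * D.val h := by
          simp only [mate_mul, mul_assoc]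
  | add z w hz hw => simp only [map_add, mul_add, add_mul, hz, hw]

theorem evalH_takeuchiMul (z : D.sourceTarget.Tensor D.sourceTarget.s)
    (w : RingTensor.takeuchi D.sourceTarget.s D.sourceTarget.tgt) {a : A}
    (hw : D.evalH w = a * D.μ) :
    D.evalH (RingTensor.takeuchiMul D.sourceTarget.s D.sourceTarget.tgt z w) =
      a * D.evalH z * D.T (D.T D.η) := by
  induction z using BalTensor.induction_on with
  | mk g h =>
    calc D.evalH (RingTensor.lmul D.sourceTarget.s D.sourceTarget.tgt g h w)
        = a * (D.mate g * D.T (D.mate h * D.T D.η)) := by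
          rw [evalH_lmul, hw, mate_mul_T_η, mate_apply, mul_assoc, mul_assoc]
      _ = a * (D.mate g * D.T (D.mate h)) * D.T (D.T D.η) := by rw [map_mul]; simp only [mul_assoc]
  | add z z' hz hz' => simp only [map_add, AddMonoidHom.add_apply, mul_add, add_mul, hz, hz']

theorem evalA_takeuchiMul (z : D.sourceTarget.Tensor (endRing ρ).subtype)
    (w : RingTensor.takeuchi (endRing ρ).subtype D.sourceTarget.tgt) {a : A}
    (hw : D.evalA w = D.μ * D.T a) :
    D.evalA (RingTensor.takeuchiMul (endRing ρ).subtype D.sourceTarget.tgt z w) =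
      D.evalA z * D.T a := by
  induction z using BalTensor.induction_on with
  | mk a' h =>
    calc D.evalA (RingTensor.lmul (endRing ρ).subtype D.sourceTarget.tgt a' h w)
        = a' * (D.μ * (D.T a * D.val h)) := by rw [evalA_lmul, hw]; simp only [mul_assoc]
      _ = a' * D.mate h * D.T a := by rw [← val_mul_T, mate_apply]; simp only [mul_assoc]
  | add z z' hz hz' => simp only [map_add, AddMonoidHom.add_apply, add_mul, hz, hz']

end RingAdjunction

/-- An adjunction `λ ⊣ ρ` with a direct summand diagram `projᵢ : ρλρ ⟶ ρ`, `injᵢ : ρ ⟶ ρλρ`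
exhibiting `ρλρ ≤ ρ`. -/
structure DepthTwoAdjunction (lam : A →+* B) (ρ : B →+* A) extends RingAdjunction lam ρ where
  n : ℕ
  inj : Fin n → A
  proj : Fin n → A
  isIntertwiner_inj : ∀ i, IsIntertwiner ρ (toRingAdjunction.T.comp ρ) (inj i)
  isIntertwiner_proj : ∀ i, IsIntertwiner (toRingAdjunction.T.comp ρ) ρ (proj i)
  sum_inj_mul_proj : ∑ i, inj i * proj i = 1

namespace DepthTwoAdjunction

variable (D : DepthTwoAdjunction lam ρ)

/-- The dual basis of the bialgebroid given by the summand diagram. -/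
def dualBasis : D.sourceTarget.DualBasis (Fin D.n) where
  elem i := D.ofMate (D.proj i) (D.isIntertwiner_proj i)
  coord i := D.pairing (D.inj i) (D.isIntertwiner_inj i)
  coord_mul_tgt i := D.pairing_mul_tgt (D.isIntertwiner_inj i)
  sum_elem_mul_tgt h := D.mate_injective (by
    simp only [map_sum, D.mate_mul_tgt, D.mate_ofMate, D.coe_pairing, mul_assoc,
      ← Finset.mul_sum, D.sum_inj_mul_proj, mul_one])

section Evaluation

variable {P : Type w} [Ring P] {p : endRing ρ →+* P} (F : TwistedEmbedding (endRing ρ) p)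

theorem eval_injective : Function.Injective (D.eval F) := fun z w hzw =>
  D.dualBasis.tensor_ext p fun i => F.injective <|
    calc F.emb (SourceTarget.coordMap p (D.dualBasis.coord i) _ z)
        = D.eval F z * F.twist (D.inj i) := D.emb_coordMap F (D.isIntertwiner_inj i) z
      _ = D.eval F w * F.twist (D.inj i) := by rw [hzw]
      _ = F.emb (SourceTarget.coordMap p (D.dualBasis.coord i) _ w) :=
        (D.emb_coordMap F (D.isIntertwiner_inj i) w).symm

theorem eval₃_injective : Function.Injective (D.eval₃ F) := fun z w hzw =>
  D.dualBasis.tensor₃_ext p fun i => D.eval_injective F <|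
    calc D.eval F (SourceTarget.coordMap₃ p (D.dualBasis.coord i) _ z)
        = D.eval₃ F z * F.twist (D.T (D.inj i)) := D.eval_coordMap₃ F (D.isIntertwiner_inj i) z
      _ = D.eval₃ F w * F.twist (D.T (D.inj i)) := by rw [hzw]
      _ = D.eval F (SourceTarget.coordMap₃ p (D.dualBasis.coord i) _ w) :=
        (D.eval_coordMap₃ F (D.isIntertwiner_inj i) w).symm

theorem mem_range_eval {a : A} (ha : ∀ i, a * F.twist (D.inj i) ∈ F.emb.range) :
    a ∈ (D.eval F).range := by
  choose x hx using ha
  refine ⟨∑ i, D.sourceTarget.tmul p (x i) (D.dualBasis.elem i), ?_⟩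
  calc D.eval F (∑ i, D.sourceTarget.tmul p (x i) (D.dualBasis.elem i))
      = ∑ i, a * F.twist (D.inj i * D.proj i) := by
        rw [map_sum]
        exact Finset.sum_congr rfl fun i _ => by
          rw [D.eval_tmul, hx, map_mul, mul_assoc, dualBasis, D.mate_ofMate]
    _ = a := by rw [← Finset.mul_sum, ← map_sum, D.sum_inj_mul_proj, map_one, mul_one]

/-- The factorization through the injective map `eval` of an additive map with values in its
range. -/
noncomputable def lift {M : Type*} [AddCommGroup M] (f : M →+ A)
    (hf : ∀ x i, f x * F.twist (D.inj i) ∈ F.emb.range) : M →+ D.sourceTarget.Tensor p :=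
  (AddMonoidHom.ofInjective (D.eval_injective F)).symm.toAddMonoidHom.comp
    (f.codRestrict (D.eval F).range fun x => D.mem_range_eval F (hf x))

theorem eval_lift {M : Type*} [AddCommGroup M] (f : M →+ A)
    (hf : ∀ x i, f x * F.twist (D.inj i) ∈ F.emb.range) (x : M) :
    D.eval F (D.lift F f hf x) = f x :=
  AddMonoidHom.apply_ofInjective_symm (D.eval_injective F)
    ⟨f x, D.mem_range_eval F (hf x)⟩

end Evaluation

/-- The comultiplication of the bialgebroid, determined by `evalH(Δ(h)) = mate(h) μ`. -/
noncomputable def comul : D.H →+ D.sourceTarget.Tensor D.sourceTarget.s :=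
  D.lift D.mateEmbedding ((AddMonoidHom.mulRight D.μ).comp D.mate) fun h i =>
    ⟨D.ofMate (D.mate h * D.μ * D.T (D.inj i))
      (((D.isIntertwiner_mate h).mul (D.isIntertwiner_μ.comp ρ)).mul
        ((D.isIntertwiner_inj i).map D.T)), D.mate_ofMate _ _⟩

theorem evalH_comul (h : D.H) : D.evalH (D.comul h) = D.mate h * D.μ := D.eval_lift _ _ _ h

/-- The coring structure of the bialgebroid. -/
@[reducible] noncomputable def coringData : RightCoringData (endRing ρ) D.H where
  toSourceTarget := D.sourceTarget
  comul := D.comul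
  counit := D.counit
  comul_left r h := D.eval_injective D.mateEmbedding (by
    rw [D.evalH_lact, evalH_comul, evalH_comul, D.mate_mul_tgt, mul_assoc])
  comul_right r h := D.eval_injective D.mateEmbedding (by
    rw [D.eval_ract, evalH_comul, evalH_comul, D.mate_mul_s, mul_assoc, ← D.μ_mul_T_T, mul_assoc]
    rfl)
  counit_left := fun r h => D.pairing_mul_tgt D.isIntertwiner_η_comp r h
  counit_right := fun r h => D.counit_mul_s h r

section Evaluation

variable {P : Type w} [Ring P] {p : endRing ρ →+* P} (F : TwistedEmbedding (endRing ρ) p)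

theorem emb_idCounit (z : D.sourceTarget.Tensor p) :
    F.emb (D.coringData.idCounit p z) = D.eval F z * F.twist D.η :=
  D.emb_coordMap F D.isIntertwiner_η_comp z

theorem eval₃_idComul (z : D.sourceTarget.Tensor p) :
    D.eval₃ F (D.coringData.idComul p z) = D.eval F z * F.twist D.μ := by
  induction z using BalTensor.induction_on with
  | mk x h =>
    calc F.emb x * F.twist (D.evalH (D.comul h)) = F.emb x * F.twist (D.mate h) * F.twist D.μ := by
          rw [evalH_comul, map_mul, mul_assoc]
  | add z w hz hw =>
    rw [map_add, map_add, map_add, add_mul, hz, hw]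

end Evaluation

theorem mate_counitId (z : D.sourceTarget.Tensor D.sourceTarget.s) :
    D.mate (D.coringData.counitId z) = D.evalH z * D.η := by
  induction z using BalTensor.induction_on with
  | mk g h =>
    calc D.mate (h * D.sourceTarget.tgt (D.counit g)) = D.mate g * (D.η * D.mate h) := by
          rw [D.mate_mul_tgt, D.coe_counit, mul_assoc]
      _ = D.mate g * D.T (D.mate h) * D.η := by rw [← D.T_mul_η, mul_assoc]
  | add z w hz hw => simp only [map_add, add_mul, hz, hw]

theorem eval₃_coactId_comul (z : D.sourceTarget.Tensor D.sourceTarget.s) :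
    D.eval₃ D.mateEmbedding
      (D.coringData.coactId D.sourceTarget.s D.comul D.coringData.comul_right z) =
      D.evalH z * D.μ := by
  induction z using BalTensor.induction_on with
  | mk g h =>
    calc D.eval₃ D.mateEmbedding
          (BalTensor.assocAux _ _ _ _ D.sourceTarget.act_comm (D.comul g) h)
        = D.mate g * (D.μ * D.T (D.T (D.mate h))) := by
          rw [D.eval₃_assocAux, evalH_comul, mul_assoc]; rfl
      _ = D.mate g * D.T (D.mate h) * D.μ := by rw [D.μ_mul_T_T, mul_assoc]
  | add z w hz hw =>
    rw [map_add, map_add, map_add, add_mul, hz, hw]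

theorem comul_mem_takeuchi (h : D.H) :
    D.comul h ∈ RingTensor.takeuchi D.sourceTarget.s D.sourceTarget.tgt := fun r =>
  D.eval_injective D.mateEmbedding <|
    calc D.evalH (RingTensor.lmul _ _ (D.source r) 1 (D.comul h))
        = D.mate h * (D.mate (D.source r) * D.T (D.val 1)) := by
          rw [D.evalH_lmul, evalH_comul, D.mate_apply (D.source r)]
          simp only [mul_assoc]
      _ = D.mate h * (D.μ * D.T r) := by rw [D.mate_source, D.val_one, map_one, mul_one]
      _ = D.evalH (RingTensor.lmul _ _ 1 (D.sourceTarget.tgt r) (D.comul h)) := by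
          rw [D.evalH_lmul, evalH_comul, D.val_one, D.val_tgt, one_mul, mul_assoc]

theorem comul_mul (g h : D.H) :
    D.comul (g * h) = RingTensor.takeuchiMul D.sourceTarget.s D.sourceTarget.tgt (D.comul g)
      ⟨D.comul h, D.comul_mem_takeuchi h⟩ :=
  D.eval_injective D.mateEmbedding <|
    calc D.evalH (D.comul (g * h))
        = D.mate h * (D.mate g * D.T D.η * D.μ) := by
          rw [evalH_comul, D.mate_mul, D.mate_mul_T_η, mul_assoc]
      _ = D.mate h * D.evalH (D.comul g) * D.T (D.T D.η) := by
          rw [evalH_comul, mul_assoc (D.mate g), ← D.μ_mul_T_T]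
          simp only [mul_assoc]
      _ = _ := (D.evalH_takeuchiMul _ _ (D.evalH_comul h)).symm

/-- The bialgebroid `(End T)ᵒᵖ` over `End ρ`. -/
noncomputable def bialgebroid : RightBialgebroid (endRing ρ) D.H where
  toRightCoringData := D.coringData
  coassoc h := D.eval₃_injective D.mateEmbedding <|
    calc D.eval₃ D.mateEmbedding
          (D.coringData.coactId D.sourceTarget.s D.comul D.coringData.comul_right (D.comul h))
        = D.mate h * D.μ * D.μ := by rw [eval₃_coactId_comul, evalH_comul]
      _ = D.evalH (D.comul h) * D.T D.μ := by
          rw [evalH_comul, mul_assoc, mul_assoc, D.μ_mul_T_μ]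
      _ = _ := (D.eval₃_idComul D.mateEmbedding (D.comul h)).symm
  counit_id_comul h := D.mate_injective <|
    calc D.mate (D.coringData.counitId (D.comul h)) = D.mate h * D.μ * D.η := by
          rw [mate_counitId, evalH_comul]
      _ = D.mate h := by rw [mul_assoc, D.μ_mul_η, mul_one]
  id_counit_comul h := D.mate_injective <|
    calc D.mate (D.coringData.idCounit D.sourceTarget.s (D.comul h))
        = D.evalH (D.comul h) * D.T D.η := D.emb_idCounit D.mateEmbedding _
      _ = D.mate h := by rw [evalH_comul, mul_assoc, D.μ_mul_T_η, mul_one]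
  comul_mem := D.comul_mem_takeuchi
  comul_one := D.eval_injective D.mateEmbedding (by
    change D.evalH (D.comul 1) = D.mate 1 * D.T (D.mate 1)
    rw [evalH_comul, D.mate_one, D.μ_mul_T_μ])
  comul_mul := D.comul_mul
  counit_one := D.counit_one
  counit_mul_s g h := (D.counit_source_counit_mul g h).symm
  counit_mul_t g h := (D.counit_tgt_counit_mul g h).symm

/-- The coaction of the bialgebroid on `A`, determined by `evalA(δ(a)) = μ T(a)`. -/
noncomputable def coaction : A →+ D.sourceTarget.Tensor (endRing ρ).subtype :=
  D.lift (.ofSubtype (endRing ρ)) ((AddMonoidHom.mulLeft D.μ).comp (D.T : A →+ A))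
    fun a i => ⟨D.μ * D.T a * D.inj i, rfl⟩

theorem evalA_coaction (a : A) : D.evalA (D.coaction a) = D.μ * D.T a := D.eval_lift _ _ _ a

theorem coaction_mul (r : endRing ρ) (a : A) :
    D.coaction (a * r) = D.sourceTarget.ract (endRing ρ).subtype r (D.coaction a) :=
  D.eval_injective (.ofSubtype (endRing ρ)) <|
    calc D.evalA (D.coaction (a * r)) = D.evalA (D.coaction a) * D.T r := by
          rw [evalA_coaction, evalA_coaction, map_mul, mul_assoc]
      _ = _ := (D.eval_ract (.ofSubtype (endRing ρ)) r (D.coaction a)).symm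

theorem eval₃_coactId_coaction (z : D.sourceTarget.Tensor (endRing ρ).subtype) :
    D.eval₃ (.ofSubtype (endRing ρ))
      (D.coringData.coactId (endRing ρ).subtype D.coaction D.coaction_mul z) =
      D.μ * D.T (D.evalA z) := by
  induction z using BalTensor.induction_on with
  | mk a h =>
    calc D.eval₃ (.ofSubtype (endRing ρ))
          (BalTensor.assocAux _ _ _ _ D.sourceTarget.act_comm (D.coaction a) h)
        = D.evalA (D.coaction a) * D.T (D.mate h) := D.eval₃_assocAux _ _ h
      _ = D.μ * D.T (a * D.mate h) := by rw [evalA_coaction, map_mul, mul_assoc]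
  | add z w hz hw =>
    simp only [map_add, mul_add, hz, hw]

theorem coaction_mem_takeuchi (a : A) :
    D.coaction a ∈ RingTensor.takeuchi (endRing ρ).subtype D.sourceTarget.tgt := fun r =>
  D.eval_injective (.ofSubtype (endRing ρ)) <|
    calc D.evalA (RingTensor.lmul _ _ (r : A) 1 (D.coaction a)) = r * (D.μ * D.T a) := by
          rw [D.evalA_lmul, evalA_coaction, D.val_one, mul_one]
      _ = D.μ * D.T a * r := by rw [← mul_assoc, D.coe_mul_μ, mul_assoc, D.coe_mul_T, mul_assoc]
      _ = D.evalA (RingTensor.lmul _ _ 1 (D.sourceTarget.tgt r) (D.coaction a)) := by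
          rw [D.evalA_lmul, evalA_coaction, D.val_tgt, one_mul]

/-- The comodule algebra structure on `A` over the bialgebroid. -/
noncomputable def comoduleAlgebra : RightComoduleAlgebra D.bialgebroid A where
  π := (endRing ρ).subtype
  δ := D.coaction
  δ_right := D.coaction_mul
  coassoc a := D.eval₃_injective (.ofSubtype (endRing ρ)) <|
    calc D.eval₃ (.ofSubtype (endRing ρ))
          (D.coringData.coactId (endRing ρ).subtype D.coaction D.coaction_mul (D.coaction a))
        = D.μ * D.T (D.μ * D.T a) := by rw [eval₃_coactId_coaction, evalA_coaction]
      _ = D.evalA (D.coaction a) * D.μ := by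
          rw [evalA_coaction, map_mul, ← mul_assoc, D.μ_mul_T_μ, mul_assoc, D.μ_mul_T_T, mul_assoc]
      _ = _ := (D.eval₃_idComul (.ofSubtype (endRing ρ)) (D.coaction a)).symm
  counit a :=
    calc D.coringData.idCounit (endRing ρ).subtype (D.coaction a)
        = D.evalA (D.coaction a) * D.η := D.emb_idCounit (.ofSubtype (endRing ρ)) _
      _ = a := by rw [evalA_coaction, mul_assoc, D.T_mul_η, ← mul_assoc, D.μ_mul_η, one_mul]
  δ_mem := D.coaction_mem_takeuchi
  δ_one := D.eval_injective (.ofSubtype (endRing ρ)) (by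
    change D.evalA (D.coaction 1) = 1 * D.mate 1
    rw [evalA_coaction, map_one, mul_one, D.mate_one, one_mul])
  δ_mul a a' := D.eval_injective (.ofSubtype (endRing ρ)) <|
    calc D.evalA (D.coaction (a * a')) = D.evalA (D.coaction a) * D.T a' := by
          rw [evalA_coaction, evalA_coaction, map_mul, mul_assoc]
      _ = _ := (D.evalA_takeuchiMul _ _ (D.evalA_coaction a')).symm

end DepthTwoAdjunction

end EndomorphismBialgebroid

section GaloisExtension

variable {A : Type v} {B : Type u} [Ring A] [Ring B] {lam : A →+* B} {ρ : B →+* A}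

namespace RightComoduleAlgebra

namespace SelfTensor

/-- The element `a ⊗ a'` of `A ⊗_B A`. -/
abbrev tmul (ρ : B →+* A) (a a' : A) : SelfTensor ρ :=
  BalTensor.mk (fun b => AddMonoidHom.mulRight (ρ b)) (fun b => AddMonoidHom.mulLeft (ρ b)) a a'

theorem mul_tmul (a a' : A) (b : B) : tmul ρ (a * ρ b) a' = tmul ρ a (ρ b * a') :=
  BalTensor.mk_balanced _ _ b a a'

/-- Left multiplication `a' ⊗ a'' ↦ a a' ⊗ a''` on `A ⊗_B A`. -/
def lmul (a : A) : SelfTensor ρ →+ SelfTensor ρ :=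
  BalTensor.map (AddMonoidHom.mulLeft a) (AddMonoidHom.id A)
    (fun b a' => (mul_assoc a a' (ρ b)).symm) (fun _ _ => rfl)

/-- Right multiplication `a' ⊗ a'' ↦ a' ⊗ a'' a` on `A ⊗_B A`. -/
def rmul (a : A) : SelfTensor ρ →+ SelfTensor ρ :=
  BalTensor.map (AddMonoidHom.id A) (AddMonoidHom.mulRight a) (fun _ _ => rfl)
    (fun b a' => mul_assoc (ρ b) a' a)

end SelfTensor

end RightComoduleAlgebra

open RightComoduleAlgebra

namespace RingAdjunction

variable (D : RingAdjunction lam ρ)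

/-- The isomorphism `A ⊗_B A ≅ A`, `a ⊗ a' ↦ a μ T(a')`, which uses that `A ≅ B` as left
`B`-modules by `a' ↦ ε λ(a')`. -/
def selfTensorEval : SelfTensor ρ →+ A :=
  BalTensor.lift (AddMonoidHom.mul.compl₂ ((AddMonoidHom.mulLeft D.μ).comp (D.T : A →+ A)))
    fun b a a' => by
      change a * ρ b * (D.μ * D.T a') = a * (D.μ * D.T (ρ b * a'))
      rw [map_mul, ← mul_assoc D.μ, μ_mul_T_apply, mul_assoc, mul_assoc]

theorem selfTensorEval_tmul (a a' : A) :
    D.selfTensorEval (SelfTensor.tmul ρ a a') = a * (D.μ * D.T a') := rfl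

theorem μ_mul_T_mul_η (a : A) : D.μ * D.T a * D.η = a := by
  rw [mul_assoc, T_mul_η, ← mul_assoc, μ_mul_η, one_mul]

theorem μ_mul_T_eq (a : A) : D.μ * D.T a = ρ (D.ε * lam a) := (map_mul ρ _ _).symm

theorem selfTensorEval_bijective : Function.Bijective D.selfTensorEval := by
  refine Function.bijective_iff_has_inverse.2
    ⟨fun a => SelfTensor.tmul ρ a D.η, fun z => ?_, fun a => ?_⟩
  · induction z using BalTensor.induction_on with
    | mk a a' =>
      calc SelfTensor.tmul ρ (a * (D.μ * D.T a')) D.η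
          = SelfTensor.tmul ρ a (D.μ * D.T a' * D.η) := by
            rw [μ_mul_T_eq]; exact SelfTensor.mul_tmul a D.η _
        _ = SelfTensor.tmul ρ a a' := by rw [μ_mul_T_mul_η]
    | add z w hz hw =>
      simp only [SelfTensor.tmul] at hz hw ⊢
      simp only [map_add, AddMonoidHom.add_apply, hz, hw]
  · beta_reduce
    rw [selfTensorEval_tmul, μ_mul_T_η, mul_one]

theorem selfTensorEval_lmul (a : A) (z : SelfTensor ρ) :
    D.selfTensorEval (SelfTensor.lmul a z) = a * D.selfTensorEval z := by
  induction z using BalTensor.induction_on with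
  | mk a' a'' => exact mul_assoc a a' _
  | add z w hz hw => simp only [map_add, mul_add, hz, hw]

theorem selfTensorEval_rmul (a : A) (z : SelfTensor ρ) :
    D.selfTensorEval (SelfTensor.rmul a z) = D.selfTensorEval z * D.T a := by
  induction z using BalTensor.induction_on with
  | mk a' a'' =>
    calc a' * (D.μ * D.T (a'' * a)) = a' * (D.μ * D.T a'') * D.T a := by
          simp only [map_mul, mul_assoc]
  | add z w hz hw => simp only [map_add, add_mul, hz, hw]

theorem rmul_one_tmul_η (a : A) :
    SelfTensor.rmul a (SelfTensor.tmul ρ 1 D.η) =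
      SelfTensor.lmul (D.T a) (SelfTensor.tmul ρ 1 D.η) :=
  calc SelfTensor.tmul ρ 1 (D.η * a) = SelfTensor.tmul ρ (1 * D.T a) D.η := by
        rw [η_mul]; exact (SelfTensor.mul_tmul 1 D.η (lam a)).symm
    _ = SelfTensor.tmul ρ (D.T a * 1) D.η := by rw [one_mul, mul_one]

theorem isSummandOf_of_selfTensor_dualBasis (D : RingAdjunction lam ρ) {ι : Type*} [Fintype ι]
    {coord : ι → SelfTensor ρ →+ A} {z : ι → SelfTensor ρ}
    (coord_lmul : ∀ i a w, coord i (SelfTensor.lmul a w) = a * coord i w)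
    (coord_rmul : ∀ i b w, coord i (SelfTensor.rmul (ρ b) w) = coord i w * ρ b)
    (z_central : ∀ i b, SelfTensor.rmul (ρ b) (z i) = SelfTensor.lmul (ρ b) (z i))
    (sum_coord : ∀ w, ∑ i, SelfTensor.lmul (coord i w) (z i) = w) :
    IsSummandOf ((ρ.comp lam).comp ρ) ρ := by
  refine IsSummandOf.of_sum_eq_one (a := fun i => coord i (SelfTensor.tmul ρ 1 D.η))
    (b := fun i => D.selfTensorEval (z i)) (fun i b => ?_) (fun i b => ?_) ?_
  · calc D.selfTensorEval (z i) * D.T (ρ b)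
        = D.selfTensorEval (SelfTensor.rmul (ρ b) (z i)) := (D.selfTensorEval_rmul _ _).symm
      _ = ρ b * D.selfTensorEval (z i) := by rw [z_central, selfTensorEval_lmul]
  · calc coord i (SelfTensor.tmul ρ 1 D.η) * ρ b
        = coord i (SelfTensor.lmul (D.T (ρ b)) (SelfTensor.tmul ρ 1 D.η)) := by
          rw [← rmul_one_tmul_η, coord_rmul]
      _ = D.T (ρ b) * coord i (SelfTensor.tmul ρ 1 D.η) := coord_lmul _ _ _
  · calc ∑ i, coord i (SelfTensor.tmul ρ 1 D.η) * D.selfTensorEval (z i)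
        = D.selfTensorEval (SelfTensor.tmul ρ 1 D.η) := by
          simp only [← selfTensorEval_lmul, ← map_sum, sum_coord]
      _ = 1 := by rw [selfTensorEval_tmul, μ_mul_T_η, mul_one]

end RingAdjunction

namespace DepthTwoAdjunction

variable (D : DepthTwoAdjunction lam ρ)

theorem evalA_bijective : Function.Bijective D.evalA :=
  ⟨D.eval_injective _, fun a => D.mem_range_eval (.ofSubtype (endRing ρ)) fun i =>
    ⟨a * D.inj i, rfl⟩⟩

theorem isCoinvariant_iff (a : A) :
    D.comoduleAlgebra.IsCoinvariant a ↔ D.μ * D.T a = a * D.μ := by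
  have evalA_tmul_one : D.evalA (D.sourceTarget.tmul (endRing ρ).subtype a 1) = a * D.μ :=
    congrArg (a * ·) D.mate_one
  rw [← D.evalA_coaction, ← evalA_tmul_one]
  exact (D.eval_injective _).eq_iff.symm

theorem isCoinvariant_apply (b : B) : D.comoduleAlgebra.IsCoinvariant (ρ b) :=
  (D.isCoinvariant_iff _).2 (D.μ_mul_T_apply b)

theorem mem_range_of_isCoinvariant {a : A} (ha : D.comoduleAlgebra.IsCoinvariant a) :
    a ∈ ρ.range :=
  ⟨D.ε * lam (a * D.η),
    calc ρ (D.ε * lam (a * D.η)) = D.μ * D.T a * D.T D.η := by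
          rw [← D.μ_mul_T_eq, map_mul, mul_assoc]
      _ = a := by rw [(D.isCoinvariant_iff a).1 ha, mul_assoc, D.μ_mul_T_η, mul_one]⟩

theorem evalA_galoisMap (z : SelfTensor ρ) :
    D.evalA (D.comoduleAlgebra.galoisMap ρ D.isCoinvariant_apply z) = D.selfTensorEval z := by
  induction z using BalTensor.induction_on with
  | mk a a' =>
    calc D.evalA (RingTensor.lmul (endRing ρ).subtype D.sourceTarget.tgt a 1 (D.coaction a'))
        = a * (D.μ * D.T a') := by rw [D.evalA_lmul, evalA_coaction, D.val_one, mul_one]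
  | add z w hz hw =>
    rw [map_add, map_add, ← hz, ← hw]
    exact map_add D.evalA _ _

theorem isGalois : D.comoduleAlgebra.IsGalois ρ :=
  ⟨D.isCoinvariant_apply, fun _ => D.mem_range_of_isCoinvariant,
    (Function.Bijective.of_comp_iff' D.evalA_bijective _).1
      ((funext D.evalA_galoisMap).symm ▸ D.selfTensorEval_bijective :
        Function.Bijective fun z => D.evalA (D.comoduleAlgebra.galoisMap ρ _ z))⟩

end DepthTwoAdjunction

theorem IsSummandOf.nonempty_depthTwoAdjunction (hlam : IsLeftAdjoint lam ρ)
    (h : IsSummandOf ((ρ.comp lam).comp ρ) ρ) : Nonempty (DepthTwoAdjunction lam ρ) := by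
  obtain ⟨D⟩ := isLeftAdjoint_iff_nonempty_ringAdjunction.1 hlam
  obtain ⟨n, inj, proj, hproj, hinj, hsum⟩ := h
  exact ⟨⟨D, n, inj, proj, hinj, hproj, hsum⟩⟩

namespace RightComoduleAlgebra

variable {R : Type*} [Ring R] {H : Type*} [Ring H] {𝓗 : RightBialgebroid R H}
  {𝓐 : RightComoduleAlgebra 𝓗 A}

theorem IsCoinvariant.commute_π {c : A} (hc : 𝓐.IsCoinvariant c) (r : R) :
    𝓐.π r * c = c * 𝓐.π r := by
  have counit_tgt : 𝓗.counit (𝓗.tgt r) = r := by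
    rw [← one_mul (𝓗.tgt r), 𝓗.counit_left, 𝓗.counit_one, mul_one]
  calc 𝓐.π r * c = 𝓗.idCounit 𝓐.π (𝓗.tmul 𝓐.π (𝓐.π r * c) (1 * 1)) := by
        change _ = 𝓐.π r * c * 𝓐.π (𝓗.counit (1 * 1))
        rw [mul_one, 𝓗.counit_one, map_one, mul_one]
    _ = 𝓗.idCounit 𝓐.π (𝓗.tmul 𝓐.π (1 * c) (𝓗.tgt r * 1)) :=
      congrArg (𝓗.idCounit 𝓐.π) (by
        have h := 𝓐.δ_mem c r
        rwa [hc] at h)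
    _ = c * 𝓐.π r := by
      change 1 * c * 𝓐.π (𝓗.counit (𝓗.tgt r * 1)) = _
      rw [one_mul, mul_one, counit_tgt]

variable {φ : H →+ R} (hφ : ∀ r h, φ (h * 𝓗.tgt r) = r * φ h)

theorem coordMap_lmul (a : A) (z : 𝓗.Tensor 𝓐.π) :
    SourceTarget.coordMap 𝓐.π φ hφ (RingTensor.lmul 𝓐.π 𝓗.tgt a 1 z) =
      a * SourceTarget.coordMap 𝓐.π φ hφ z := by
  induction z using BalTensor.induction_on with
  | mk x h =>
    calc a * x * 𝓐.π (φ (1 * h)) = a * (x * 𝓐.π (φ h)) := by rw [one_mul, mul_assoc]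
  | add z w hz hw => simp only [map_add, mul_add, hz, hw]

theorem coordMap_δ_mul {c : A} (hc : 𝓐.IsCoinvariant c) (a : A) :
    SourceTarget.coordMap 𝓐.π φ hφ (𝓐.δ (a * c)) =
      SourceTarget.coordMap 𝓐.π φ hφ (𝓐.δ a) * c := by
  rw [𝓐.δ_mul]
  generalize 𝓐.δ a = z
  induction z using BalTensor.induction_on with
  | mk x h =>
    calc SourceTarget.coordMap 𝓐.π φ hφ (RingTensor.lmul 𝓐.π 𝓗.tgt x h (𝓐.δ c))
        = x * c * 𝓐.π (φ (h * 1)) := by rw [hc]; rfl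
      _ = x * 𝓐.π (φ h) * c := by rw [mul_one, mul_assoc, mul_assoc, hc.commute_π]
  | add z w hz hw => simp only [map_add, AddMonoidHom.add_apply, add_mul, hz, hw]

variable (hρ : ∀ b, 𝓐.IsCoinvariant (ρ b))

theorem galoisMap_lmul (a : A) (z : SelfTensor ρ) :
    𝓐.galoisMap ρ hρ (SelfTensor.lmul a z) =
      RingTensor.lmul 𝓐.π 𝓗.tgt a 1 (𝓐.galoisMap ρ hρ z) := by
  induction z using BalTensor.induction_on with
  | mk x y =>
    calc RingTensor.lmul 𝓐.π 𝓗.tgt (a * x) 1 (𝓐.δ y)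
        = RingTensor.lmul 𝓐.π 𝓗.tgt a 1 (RingTensor.lmul 𝓐.π 𝓗.tgt x 1 (𝓐.δ y)) := by
          rw [← RingTensor.lmul_mul, mul_one]
  | add z w hz hw => simp only [map_add, hz, hw]

theorem coordMap_galoisMap_lmul (a : A) (z : SelfTensor ρ) :
    SourceTarget.coordMap 𝓐.π φ hφ (𝓐.galoisMap ρ hρ (SelfTensor.lmul a z)) =
      a * SourceTarget.coordMap 𝓐.π φ hφ (𝓐.galoisMap ρ hρ z) := by
  rw [galoisMap_lmul, coordMap_lmul]

theorem coordMap_galoisMap_rmul (b : B) (z : SelfTensor ρ) :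
    SourceTarget.coordMap 𝓐.π φ hφ (𝓐.galoisMap ρ hρ (SelfTensor.rmul (ρ b) z)) =
      SourceTarget.coordMap 𝓐.π φ hφ (𝓐.galoisMap ρ hρ z) * ρ b := by
  induction z using BalTensor.induction_on with
  | mk x y =>
    calc SourceTarget.coordMap 𝓐.π φ hφ (RingTensor.lmul 𝓐.π 𝓗.tgt x 1 (𝓐.δ (y * ρ b)))
        = SourceTarget.coordMap 𝓐.π φ hφ (RingTensor.lmul 𝓐.π 𝓗.tgt x 1 (𝓐.δ y)) * ρ b := by
          rw [coordMap_lmul, coordMap_lmul, coordMap_δ_mul hφ (hρ b), mul_assoc]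
  | add z w hz hw => simp only [map_add, add_mul, hz, hw]

theorem isSummandOf_of_galoisMap_bijective (hΓ : Function.Bijective (𝓐.galoisMap ρ hρ))
    (hH : 𝓗.IsLeftFiniteProjective) (hlam : IsLeftAdjoint lam ρ) :
    IsSummandOf ((ρ.comp lam).comp ρ) ρ := by
  obtain ⟨n, ⟨𝓑⟩⟩ := hH.exists_dualBasis
  obtain ⟨D⟩ := isLeftAdjoint_iff_nonempty_ringAdjunction.1 hlam
  choose z hz using fun i => hΓ.surjective (𝓗.tmul 𝓐.π 1 (𝓑.elem i))
  refine D.isSummandOf_of_selfTensor_dualBasis (z := z)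
    (coord := fun i =>
      (SourceTarget.coordMap 𝓐.π (𝓑.coord i) (𝓑.coord_mul_tgt i)).comp (𝓐.galoisMap ρ hρ))
    (fun i => coordMap_galoisMap_lmul (𝓑.coord_mul_tgt i) hρ)
    (fun i => coordMap_galoisMap_rmul (𝓑.coord_mul_tgt i) hρ)
    (fun i b => ?_) (fun w => ?_)
  · refine hΓ.injective (𝓑.tensor_ext 𝓐.π fun j => ?_)
    rw [coordMap_galoisMap_rmul, coordMap_galoisMap_lmul, hz]
    change 1 * 𝓐.π (𝓑.coord j (𝓑.elem i)) * ρ b = ρ b * (1 * 𝓐.π (𝓑.coord j (𝓑.elem i)))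
    rw [one_mul, (hρ b).commute_π]
  · refine hΓ.injective (Eq.trans ?_ (𝓑.sum_coordMap 𝓐.π (𝓐.galoisMap ρ hρ w)))
    simp only [map_sum, galoisMap_lmul, hz, RingTensor.lmul_tmul, mul_one, one_mul,
      AddMonoidHom.comp_apply]

end RightComoduleAlgebra

end GaloisExtension

theorem mainTheorem5 {B : Type u} {A : Type v} [Ring B] [Ring A] (ρ : B →+* A) :
    List.TFAE [
      (∃ (H : Type v) (_ : Ring H) (𝓗 : RightBialgebroid (endRing ρ) H)
          (𝓐 : RightComoduleAlgebra 𝓗 A),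
          𝓗.IsLeftFiniteProjective ∧ 𝓐.IsGalois ρ) ∧
        IsLeftRegularHom ρ,
      (∃ (H : Type v) (_ : Ring H) (𝓗 : RightBialgebroid (endRing ρ) H)
          (𝓐 : RightComoduleAlgebra 𝓗 A),
          𝓐.π = (endRing ρ).subtype ∧ 𝓗.IsLeftFiniteProjective ∧ 𝓐.IsGalois ρ) ∧
        IsLeftRegularHom ρ,
      ∃ lam : A →+* B, IsLeftAdjoint lam ρ ∧ IsSummandOf ((ρ.comp lam).comp ρ) ρ,
      (∃ lam : A →+* B, IsLeftAdjoint lam ρ) ∧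
        ∀ lam : A →+* B, IsLeftAdjoint lam ρ → IsSummandOf ((ρ.comp lam).comp ρ) ρ] := by
  rw [isLeftRegularHom_iff_exists_isLeftAdjoint]
  tfae_have 2 → 1
  | ⟨⟨H, _, 𝓗, 𝓐, _, hH, hG⟩, hlam⟩ => ⟨⟨H, _, 𝓗, 𝓐, hH, hG⟩, hlam⟩
  tfae_have 1 → 3
  | ⟨⟨_, _, _, _, hH, hρ, _, hΓ⟩, lam, hlam⟩ =>
    ⟨lam, hlam, RightComoduleAlgebra.isSummandOf_of_galoisMap_bijective hρ hΓ hH hlam⟩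
  tfae_have 3 → 4
  | ⟨lam, hlam, h⟩ => ⟨⟨lam, hlam⟩, fun _ hlam' => hlam.comp_comp_isSummandOf hlam' h⟩
  tfae_have 4 → 2 := by
    rintro ⟨⟨lam, hlam⟩, h⟩
    obtain ⟨D⟩ := (h lam hlam).nonempty_depthTwoAdjunction hlam
    exact ⟨⟨D.H, inferInstance, D.bialgebroid, D.comoduleAlgebra, rfl,
      D.dualBasis.isLeftFiniteProjective, D.isGalois⟩, lam, hlam⟩
  tfae_finish
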